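/- **Conventions.** A *rectangle* of a topological space $X$ is an open set $R\subseteq X$ with a continuous map $[\cdot,\cdot]_R:R\times R\to R$ such that $[x,x]=x$, $[[x,y],z]=[x,z]=[x,[y,z]]$; its plaques are $P_+(R,x)=\{y\in R:[x,y]=x\}$ and $P_-(R,x)=\{y\in R:[x,y]=y\}$. Two rectangles are compatible if every point of $X$ has a neighborhood on which their brackets agree wherever both are defined. A *local product structure* $\mathcal L$ on $X$ is a covering of $X$ by pairwise compatible rectangles; a rectangle compatible with all of them is called a rectangle of $(X,\mathcal L)$. A continuous map preserves local product structures if every point has a rectangular neighborhood $R$ whose image is a rectangle, the map carrying the bracket of $R$ to that of the image. A *Smale space* $(X,f)$ is a compact metric space $X$ with a local product structure and a homeomorphism $f:X\to X$ preserving it, for which there are $C>0$ and $\lambda\in(0,1)$ such that every point has a rectangular neighborhood $R$ with $d(f^n(y),f^n(z))\le C\lambda^n d(y,z)$ for all $n\ge 0$ and all $y,z$ in a common plaque $P_+(R,w)$, $w\in R$, and $d(f^{-n}(y),f^{-n}(z))\le C\lambda^n d(y,z)$ for all $n\ge0$ and all $y,z$ in a common plaque $P_-(R,w)$, $w\in R$.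 The stable leaf $W_+(x)$ is the set of $y$ with $d(f^n(x),f^n(y))\to0$ as $n\to+\infty$; the unstable leaf $W_-(x)$ is the stable leaf of $x$ for $f^{-1}$. Fix a closed symmetric neighborhood $U\subseteq X\times X$ of the diagonal such that $(f^n(x),f^n(y))\in U$ for all $n\in\mathbb Z$ implies $x=y$. For $x,y$ in one stable leaf $W$ let $\ell_+(x,y)\in\mathbb Z\cup\{\infty\}$ be the largest $m$ such that $(f^k(x),f^k(y))\in U$ for all $k\ge -m$. The sets $\{y\in W:\ell_+(x,y)\ge n\}$ are the basic neighborhoods of $x$ in the *internal topology* of $W$. For $n\in\mathbb R$ let $d_n$ be the combinatorial distance (possibly $\infty$) in the graph with vertex set $W$ in which $x\ne y$ are adjacent iff $\ell_+(x,y)\ge n$. A number $\alpha>0$ is a *stable lower exponent* if there is $C>0$ such that $d_n(x,y)\ge Ce^{\alpha(n-\ell_+(x,y))}$ for all stable leaves $W$, all $x\neq y$ in $W$ and all $n\in\mathbb R$, and a *stable upper exponent* if there is $C>0$ such that $d_n(x,y)\le Ce^{\alpha(n-\ell_+(x,y))}$ for all stable leaves $W$, all $x\ne y$ in $W$ and all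 real $n\ge\ell_+(x,y)$. The stable lower critical exponent $a_0\in[0,\infty]$ is the supremum of the stable lower exponents, the stable upper critical exponent $a_1\in[0,\infty]$ is the infimum of the stable upper exponents. The unstable notions ($\ell_-$, $b_0$, $b_1$, the internal topology of unstable leaves) are the stable ones for $f^{-1}$. The Smale space has *pinched spectrum* if $a_0/a_1+b_0/b_1>1$. A *splitting* of $(X,f)$ is a surjective covering map $\pi:M\to X$, where $M$ is a space with a global direct product structure (a bracket as above defined on all of $M$), such that $\pi$ preserves the local product structures, and for every $m\in M$ the restriction of $\pi$ to $P_+(M,m)$, resp. $P_-(M,m)$, is a homeomorphism onto $W_+(\pi(m))$, resp. $W_-(\pi(m))$, with its internal topology. $(X,f)$ is *splittable* if it has a splitting. Given $x_0\in X$, $x\in W_+(x_0)$, $y\in W_-(x_0)$, we say that *$y$ can be continued to $x$ with result $z$* if there are points $x_0,x_1,\dots,x_m=x$ and $z_0=y,z_1,\dots,z_m=z$ and connected rectangles $R_0,\dots,R_{m-1}$ of $X$ such that $x_i\in R_i$, $x_{i+1}\in P_+(R_i,x_i)$, $z_i\in P_-(R_i,x_i)$ and $z_{i+1}=[x_{i+1},z_i]_{R_i}$.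 **Theorem.** Let $(X,f)$ be a Smale space with pinched spectrum such that $X$ is connected and locally connected. Then $(X,f)$ is splittable. More precisely, for every $x_0\in X$, every $y\in W_-(x_0)$ can be continued to every $x\in W_+(x_0)$, the result $\pi(x,y)$ is unique, and the map $\pi:W_+(x_0)\times W_-(x_0)\to X$ is a splitting, where the leaves carry their internal topologies and the product carries the bracket $[(x,y),(x',y')]=(x,y')$. -/

import Mathlib

open Set Filter Topology

universe u v

noncomputable section

/-! ### Rectangles and local product structures -/

/-- An open set `carrier ⊆ X` with a direct product structure `br` on it, written `[x, y]`.  For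
`carrier = A × B` the bracket is `[(x₁, y₁), (x₂, y₂)] = (x₁, y₂)`.  The values of `br` outside of
`carrier × carrier` are irrelevant. -/
structure Rectangle (X : Type u) [TopologicalSpace X] where
  carrier : Set X
  isOpen_carrier : IsOpen carrier
  br : X → X → X
  br_mem : ∀ x ∈ carrier, ∀ y ∈ carrier, br x y ∈ carrier
  continuousOn_br : ContinuousOn (fun p : X × X => br p.1 p.2) (carrier ×ˢ carrier)
  br_self : ∀ x ∈ carrier, br x x = x
  br_br_left : ∀ x ∈ carrier, ∀ y ∈ carrier, ∀ z ∈ carrier, br (br x y) z = br x z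
  br_br_right : ∀ x ∈ carrier, ∀ y ∈ carrier, ∀ z ∈ carrier, br x (br y z) = br x z

namespace Rectangle

variable {X : Type u} [TopologicalSpace X]

/-- The first (stable) plaque `P₁(R, x) = {y ∈ R : [x, y] = x}`; it is `A × {b}` for
`R = A × B` and `x = (a, b)`. -/
def plaque₁ (R : Rectangle X) (x : X) : Set X := {y ∈ R.carrier | R.br x y = x}

/-- The second (unstable) plaque `P₂(R, x) = {y ∈ R : [x, y] = y}`; it is `{a} × B` for
`R = A × B` and `x = (a, b)`. -/
def plaque₂ (R : Rectangle X) (x : X) : Set X := {y ∈ R.carrier | R.br x y = y}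

/-- Two open rectangles are compatible if every point of the space has a neighbourhood on which
the two brackets agree wherever both are defined. -/
def Compatible (R S : Rectangle X) : Prop :=
  ∀ x : X, ∃ N ∈ 𝓝 x, ∀ y ∈ N ∩ R.carrier ∩ S.carrier, ∀ z ∈ N ∩ R.carrier ∩ S.carrier,
    R.br y z = S.br y z

/-- The global direct product structure of a product space. -/
def prod (A : Type u) (B : Type v) [TopologicalSpace A] [TopologicalSpace B] :
    Rectangle (A × B) where
  carrier := univ
  isOpen_carrier := isOpen_univ
  br p q := (p.1, q.2)
  br_mem := fun _ _ _ _ => mem_univ _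
  continuousOn_br := by fun_prop
  br_self := fun _ _ => rfl
  br_br_left := fun _ _ _ _ _ _ => rfl
  br_br_right := fun _ _ _ _ _ _ => rfl

end Rectangle

/-- A local product structure: a covering by pairwise compatible open rectangles. -/
structure LocalProductStructure (X : Type u) [TopologicalSpace X] where
  rects : Set (Rectangle X)
  cover : ∀ x : X, ∃ R ∈ rects, x ∈ R.carrier
  compat : ∀ R ∈ rects, ∀ S ∈ rects, R.Compatible S

namespace LocalProductStructure

variable {X : Type u} [TopologicalSpace X] {Y : Type v} [TopologicalSpace Y]

/-- `R` is a (sub-)rectangle of the space with local product structure `L`. -/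
def IsSubrectangle (L : LocalProductStructure X) (R : Rectangle X) : Prop :=
  ∀ S ∈ L.rects, R.Compatible S

/-- The local product structure given by one global direct product structure. -/
def ofRectangle (D : Rectangle X) (hD : ∀ x, x ∈ D.carrier) : LocalProductStructure X where
  rects := {D}
  cover := fun x => ⟨D, rfl, hD x⟩
  compat := by
    rintro R rfl S rfl x
    exact ⟨univ, univ_mem, fun _ _ _ _ => rfl⟩

/-- A map preserves (agrees with) local product structures if each point has a rectangular
neighbourhood `R` whose image is a rectangle on which the bracket is the image bracket. -/
def Preserves (L : LocalProductStructure X) (L' : LocalProductStructure Y) (g : X → Y) : Prop :=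
  Continuous g ∧ ∀ x : X, ∃ R : Rectangle X, ∃ S : Rectangle Y,
    L.IsSubrectangle R ∧ L'.IsSubrectangle S ∧ x ∈ R.carrier ∧ S.carrier = g '' R.carrier ∧
    ∀ y ∈ R.carrier, ∀ z ∈ R.carrier, g (R.br y z) = S.br (g y) (g z)

/-- One step of the continuation of a holonomy.  A pair `(x, z)` with `z` in the unstable plaque of
`x` in a connected rectangle `R` is moved to `(x', [x', z]_R)`, where `x'` is in the stable plaque
of `x` in `R`: the point `z` is moved by the holonomy `P₂(R, x) → P₂(R, x')`. -/
def HolonomyStep (L : LocalProductStructure X) (p q : X × X) : Prop :=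
  ∃ R : Rectangle X, L.IsSubrectangle R ∧ IsConnected R.carrier ∧ p.1 ∈ R.carrier ∧
    q.1 ∈ R.plaque₁ p.1 ∧ p.2 ∈ R.plaque₂ p.1 ∧ q.2 = R.br q.1 p.2

/-- `y` (in the unstable leaf of `x₀`) can be continued along the stable leaf of `x₀` from `x₀` to
`x`, and `z` is the result: there are `x₀, x₁, …, xₘ = x` and `z₀ = y, z₁, …, zₘ = z` with
`zᵢ₊₁ = [xᵢ₊₁, zᵢ]` in a connected rectangle having `xᵢ, xᵢ₊₁` in one stable plaque and `xᵢ, zᵢ` in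
one unstable plaque. -/
def ContinuesTo (L : LocalProductStructure X) (x₀ y x z : X) : Prop :=
  Relation.ReflTransGen L.HolonomyStep (x₀, y) (x, z)

end LocalProductStructure

/-! ### Smale spaces -/

variable {X : Type u} [MetricSpace X]

/-- `f` makes the (compact) metric space `X` with the local product structure `L` a Smale space. -/
def IsSmaleSpace (f : X ≃ₜ X) (L : LocalProductStructure X) : Prop :=
  L.Preserves L f ∧
  ∃ C > (0 : ℝ), ∃ r : ℝ, 0 < r ∧ r < 1 ∧ ∀ x : X, ∃ R : Rectangle X,
    L.IsSubrectangle R ∧ x ∈ R.carrier ∧ ∀ w ∈ R.carrier,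
      (∀ y ∈ R.plaque₁ w, ∀ z ∈ R.plaque₁ w, ∀ n : ℕ,
        dist ((f ^ n) y) ((f ^ n) z) ≤ C * r ^ n * dist y z) ∧
      (∀ y ∈ R.plaque₂ w, ∀ z ∈ R.plaque₂ w, ∀ n : ℕ,
        dist ((f.symm ^ n) y) ((f.symm ^ n) z) ≤ C * r ^ n * dist y z)

/-- A closed symmetric neighbourhood of the diagonal witnessing that `f` is expansive. -/
structure IsExpansivityNhd (f : X ≃ₜ X) (U : Set (X × X)) : Prop where
  isClosed : IsClosed U
  mem_nhds : U ∈ 𝓝ˢ (diagonal X)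
  symm : ∀ x y, (x, y) ∈ U → (y, x) ∈ U
  expansive : ∀ x y, (∀ n : ℤ, ((f ^ n) x, (f ^ n) y) ∈ U) → x = y

/-! In the following, the stable notions are defined for `f`; the unstable ones are the stable
ones of `f.symm`. -/

/-- The stable leaf of `x`. -/
def stableLeaf (f : X ≃ₜ X) (x : X) : Set X :=
  {y | Tendsto (fun n : ℕ => dist ((f ^ n) x) ((f ^ n) y)) atTop (𝓝 0)}

/-- The internal log-scale `ℓ₊(x, y)`: the biggest `m` such that `(fᵏ(x), fᵏ(y)) ∈ U` for all
`k ≥ -m`.  It is `⊤` for `x = y`, and an integer for distinct stably equivalent points. -/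
def logScale (f : X ≃ₜ X) (U : Set (X × X)) (x y : X) : EReal :=
  sSup {t : EReal | ∃ m : ℤ, t = ((m : ℝ) : EReal) ∧
    ∀ k : ℤ, -m ≤ k → ((f ^ k) x, (f ^ k) y) ∈ U}

/-- The graph `Γₙ(W)` on the stable leaf `W` of `x₀`: two different points are adjacent if and only
if `ℓ₊ ≥ n`. -/
def leafGraph (f : X ≃ₜ X) (U : Set (X × X)) (x₀ : X) (n : ℝ) :
    SimpleGraph (stableLeaf f x₀) :=
  SimpleGraph.fromRel fun y z => (n : EReal) ≤ logScale f U y z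

/-- `α` is a stable lower exponent.  (For equal points the inequality holds trivially, as
`exp (-∞) = 0`.) -/
def IsLowerExponent (f : X ≃ₜ X) (U : Set (X × X)) (α : ℝ) : Prop :=
  0 < α ∧ ∃ C > (0 : ℝ), ∀ (x₀ : X) (y z : stableLeaf f x₀), y ≠ z → ∀ n : ℝ,
    ENNReal.ofReal (C * Real.exp (α * (n - (logScale f U y z).toReal))) ≤
      ((leafGraph f U x₀ n).edist y z : ENNReal)

/-- `α` is a stable upper exponent.  (For equal points there is no `n ≥ ℓ₊ = ∞`.) -/
def IsUpperExponent (f : X ≃ₜ X) (U : Set (X × X)) (α : ℝ) : Prop :=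
  0 < α ∧ ∃ C > (0 : ℝ), ∀ (x₀ : X) (y z : stableLeaf f x₀), y ≠ z →
    ∀ n : ℝ, logScale f U y z ≤ (n : EReal) →
      ((leafGraph f U x₀ n).edist y z : ENNReal) ≤
        ENNReal.ofReal (C * Real.exp (α * (n - (logScale f U y z).toReal)))

/-- The stable lower critical exponent. -/
def lowerCriticalExponent (f : X ≃ₜ X) (U : Set (X × X)) : ENNReal :=
  ⨆ (α : ℝ) (_ : IsLowerExponent f U α), ENNReal.ofReal α

/-- The stable upper critical exponent. -/
def upperCriticalExponent (f : X ≃ₜ X) (U : Set (X × X)) : ENNReal :=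
  ⨅ (α : ℝ) (_ : IsUpperExponent f U α), ENNReal.ofReal α

/-- `a₀ / a₁ + b₀ / b₁ > 1`. -/
def PinchedSpectrum (f : X ≃ₜ X) (U : Set (X × X)) : Prop :=
  1 < lowerCriticalExponent f U / upperCriticalExponent f U +
    lowerCriticalExponent f.symm U / upperCriticalExponent f.symm U

/-! ### Leaves with the internal topology, and splittings -/

/-- The stable leaf of `x₀`, to be endowed with its internal topology. -/
def Leaf (f : X ≃ₜ X) (_U : Set (X × X)) (x₀ : X) : Type u := stableLeaf f x₀

/-- The point of `X` underlying a point of a leaf. -/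
def Leaf.val {f : X ≃ₜ X} {U : Set (X × X)} {x₀ : X} (y : Leaf f U x₀) : X := Subtype.val y

/-- The internal topology: the sets `{z ∈ W : ℓ₊(y, z) ≥ n}` are the basic neighbourhoods of `y`. -/
instance (f : X ≃ₜ X) (U : Set (X × X)) (x₀ : X) : TopologicalSpace (Leaf f U x₀) where
  IsOpen O := ∀ y ∈ O, ∃ n : ℝ, ∀ z : Leaf f U x₀, (n : EReal) ≤ logScale f U y.val z.val → z ∈ O
  isOpen_univ := fun _ _ => ⟨0, fun _ _ => mem_univ _⟩
  isOpen_inter := by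
    rintro s t hs ht y ⟨hys, hyt⟩
    obtain ⟨n, hn⟩ := hs y hys
    obtain ⟨m, hm⟩ := ht y hyt
    refine ⟨max n m, fun z hz => ⟨hn z (le_trans ?_ hz), hm z (le_trans ?_ hz)⟩⟩
    · exact EReal.coe_le_coe_iff.2 (le_max_left n m)
    · exact EReal.coe_le_coe_iff.2 (le_max_right n m)
  isOpen_sUnion := by
    rintro S hS y ⟨s, hs, hys⟩
    obtain ⟨n, hn⟩ := hS s hs y hys
    exact ⟨n, fun z hz => ⟨s, hs, hn z hz⟩⟩

/-- `π : M → X` is a splitting, where `M` carries the global direct product structure `D`. -/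
structure IsSplitting (f : X ≃ₜ X) (U : Set (X × X)) (L : LocalProductStructure X)
    {M : Type v} [TopologicalSpace M] (D : Rectangle M) (π : M → X) : Prop where
  carrier_eq : ∀ m, m ∈ D.carrier
  isCoveringMap : IsCoveringMap π
  surjective : Function.Surjective π
  preserves : (LocalProductStructure.ofRectangle D carrier_eq).Preserves L π
  stable : ∀ m : M, ∃ h : D.plaque₁ m ≃ₜ Leaf f U (π m), ∀ m', (h m').val = π m'
  unstable : ∀ m : M, ∃ h : D.plaque₂ m ≃ₜ Leaf f.symm U (π m), ∀ m', (h m').val = π m'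

/-- The Smale space has a splitting. -/
def IsSplittable (f : X ≃ₜ X) (U : Set (X × X)) (L : LocalProductStructure X) : Prop :=
  ∃ (M : Type u) (_ : TopologicalSpace M) (D : Rectangle M) (π : M → X), IsSplitting f U L D π

end

/-!
A point of the stable leaf of `x` at log-scale `n` and a point of its unstable leaf at log-scale `m`
span a rectangle with the corner `x` as soon as `n + m` is big (`exists_productScales`): a power of
`f` makes both sides short.  So a holonomy along a long unstable path exists step by step, over a
piece of the stable leaf of `x₀`, as long as the images of this piece stay bounded, where the steps
have log-scale `s` and the images have log-scale at least `-s`, up to constants.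

Such a bound comes from counting.  A piece of the stable leaf is covered by a chain of steps of
log-scale `t`, the number of which is bounded by an upper exponent.  Sides of small rectangles are
transported with a uniform loss of log-scale (`corner_transfer`), so the transported piece is
covered by a chain of the same number of steps of about the same log-scale, and a lower exponent
bounds the log-scale of its end points.  The uniform loss along the whole column needs the same
bound for the columns, with the roles of the directions exchanged.  If `α₀ ≤ α₁` and `β₀ ≤ β₁` are
lower and upper exponents of the two directions, then both bounds hold for `s = λσ` and `t = λτ`
with `σ + τ = 1` and a big `λ` if `α₁ τ < α₀` and `β₁ σ < β₀`, and such `σ`, `τ` exist if and only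
if `α₀ / α₁ + β₀ / β₁ > 1` (`exists_scales_of_pinching`, `exists_isHolonomyOn`).

Two holonomies that agree on the axes agree everywhere, because the fourth corner of a small
rectangle is unique and points of a leaf are connected by arbitrarily fine chains (`eq_of_chains`);
the upper exponents imply that such chains can be chosen near to their initial point.  Hence the
holonomies on bounded pieces of leaves fit together to `P x₀ : W₊(x₀) × W₋(x₀) → X`, and they are
compatible with changes of the base point (`HolonomySystem.base_change`).  By a change of the base
point, the holonomy between two leaves is a bijection, and over a small rectangle of `X` the
projection `P x₀` is inverted by holonomies based at a point of the fibre; this gives the covering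
property, with the sheets of `HolonomySystem.SameSheet`.

The holonomy is a composition of steps in images of small connected rectangles under powers of `f`
(`HolonomySystem.continuesTo`).  Conversely, the bracket of an arbitrary connected rectangle is
the holonomy (`HolonomySystem.br_eq`), so every continuation has the result `P x₀ x y`
(`HolonomySystem.eq_of_continuesTo`).
-/

noncomputable section

/-! ### Pairs of logarithmic scales -/

/-- A logarithmic scale on `X`, given by the relations `E n x y`, read as `ℓ(x, y) ≥ n`: an
ultrametric up to the additive constant `c`. -/
structure IsLogScale {X : Type*} (E : ℤ → X → X → Prop) (c : ℤ) : Prop where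
  nonneg : 0 ≤ c
  refl : ∀ n x, E n x x
  symm : ∀ {n x y}, E n x y → E n y x
  mono : ∀ {n m x y}, E n x y → m ≤ n → E m x y
  trans : ∀ {n x y z}, E n x y → E n y z → E (n - c) x z

/-- Two transversal logarithmic scales: `E` measures the stable, and `F` the unstable distance.  The
condition `prod` provides the fourth corner `w = [y, z]` of a rectangle with the corner `x` and two
perpendicular sides of log-scales `n` and `m`.  It exists as soon as `n + m` is big, so one of the
sides may be arbitrarily long, provided that the other one is correspondingly short. -/
structure ProductScales {X : Type*} (E F : ℤ → X → X → Prop) (c : ℤ) : Prop where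
  fst : IsLogScale E c
  snd : IsLogScale F c
  sep : ∀ {n m x y}, E n x y → F m x y → 0 ≤ n + m → x = y
  prod : ∀ {n m x y z}, E n x y → F m x z → c ≤ n + m → ∃ w, F (m - c) y w ∧ E (n - c) z w

/-- `StepChain r k x y`: there is a chain of `k` steps `r` from `x` to `y`. -/
def StepChain {X : Type*} (r : X → X → Prop) : ℕ → X → X → Prop
  | 0, x, y => x = y
  | k + 1, x, y => ∃ w, StepChain r k x w ∧ r w y

/-- `α` is an upper exponent of the scale `E`, with the constant `C`: points of log-scale `m` are
connected by chains of at most `C exp (α (n - m))` steps of log-scale `n`. -/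
def UpperExp {X : Type*} (E : ℤ → X → X → Prop) (α C : ℝ) : Prop :=
  ∀ (m n : ℤ) (x y : X), m ≤ n → E m x y →
    ∃ k : ℕ, (k : ℝ) ≤ C * Real.exp (α * (n - m)) ∧ StepChain (E n) k x y

/-- `α` is a lower exponent of the scale `E`, with the constant `C`: a chain of less than
`C exp (α (n - m))` steps of log-scale `n` connects points of log-scale at least `m`. -/
def LowerExp {X : Type*} (E : ℤ → X → X → Prop) (α C : ℝ) : Prop :=
  ∀ (n m : ℤ) (k : ℕ) (x y : X), StepChain (E n) k x y →
    (k : ℝ) < C * Real.exp (α * (n - m)) → E m x y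

/-- Points of log-scale `m` are connected by arbitrarily fine chains that stay at log-scale
`m - D` of the initial point. -/
def HasFineChains {X : Type*} (E : ℤ → X → X → Prop) (D : ℤ) : Prop :=
  0 ≤ D ∧ ∀ (m : ℤ) (x y : X), E m x y → ∀ n : ℤ,
    Relation.ReflTransGen (fun u v => E n u v ∧ E (m - D) x u ∧ E (m - D) x v) x y

variable {X : Type*} {E F : ℤ → X → X → Prop} {c : ℤ}

namespace IsLogScale

theorem trans' (h : IsLogScale E c) {n m k : ℤ} {x y z : X} (h₁ : E n x y) (h₂ : E m y z)
    (hn : k + c ≤ n) (hm : k + c ≤ m) : E k x z :=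
  h.mono (h.trans (h.mono h₁ hn) (h.mono h₂ hm)) (by omega)

theorem of_stepChain (h : IsLogScale E c) {n : ℤ} {k : ℕ} {x y : X}
    (hk : StepChain (E n) k x y) : E (n - c * k) x y := by
  induction k generalizing y with
  | zero => cases hk; exact h.refl _ _
  | succ k ih =>
    obtain ⟨w, hw, hy⟩ := hk
    have hc := h.nonneg
    have : 0 ≤ c * k := by positivity
    refine h.trans' (ih hw) hy ?_ ?_ <;> push_cast <;> linarith [mul_add c k 1]

/-- An upper exponent provides fine chains: a chain is subdivided repeatedly, with a bounded number
of new points per step, so the distances of the new points from the old ones form a geometric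
series. -/
theorem exists_hasFineChains (h : IsLogScale E c) {α C : ℝ} (hU : UpperExp E α C) :
    ∃ D : ℤ, HasFineChains E D := by
  have hc := h.nonneg
  -- One step of the subdivision refines the scale by `c + 1` and uses at most `N` new points.
  obtain ⟨N, hN⟩ := exists_nat_ge (C * Real.exp (α * (c + 1)))
  have hcN : 0 ≤ c * N := by positivity
  have first : ∀ (m : ℤ) (x y : X), E m x y →
      Relation.ReflTransGen (fun u v => E (m + (c + 1)) u v ∧ E (m - c * N) x u ∧
        E (m - c * N) x v) x y := by
    intro m x y hxy
    obtain ⟨k, hk, hch⟩ := hU m (m + (c + 1)) x y (by omega) hxy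
    have hkN : k ≤ N := by
      have : (k : ℝ) ≤ N := by
        refine hk.trans (le_trans (le_of_eq ?_) hN)
        push_cast; ring_nf
      exact_mod_cast this
    clear hk
    have key : ∀ j ≤ N, ∀ v, StepChain (E (m + (c + 1))) j x v → E (m - c * N) x v := by
      intro j hj v hv
      refine h.mono (h.of_stepChain hv) ?_
      have : c * j ≤ c * N := by gcongr
      omega
    clear hxy
    induction k generalizing y with
    | zero => cases hch; exact .refl
    | succ k ih =>
      obtain ⟨w, hw, hy⟩ := hch
      exact (ih w hw (by omega)).tail ⟨hy, key _ (by omega) _ hw, key _ hkN _ ⟨w, hw, hy⟩⟩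
  have iter : ∀ (j : ℕ) (m : ℤ) (x y : X), E m x y →
      Relation.ReflTransGen (fun u v => E (m + j * (c + 1)) u v ∧ E (m - (c * N + c)) x u ∧
        E (m - (c * N + c)) x v) x y := by
    intro j
    induction j with
    | zero =>
      intro m x y hxy
      exact .single ⟨h.mono hxy (by simp), h.refl _ _, h.mono hxy (by omega)⟩
    | succ j ih =>
      intro m x y hxy
      have h1 := first m x y hxy
      have h2 : ∀ u v, (E (m + (c + 1)) u v ∧ E (m - c * N) x u ∧ E (m - c * N) x v) →
          Relation.ReflTransGen (fun u v => E (m + (j + 1 : ℕ) * (c + 1)) u v ∧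
            E (m - (c * N + c)) x u ∧ E (m - (c * N + c)) x v) u v := by
        rintro u v ⟨huv, hxu, -⟩
        refine Relation.ReflTransGen.mono ?_ _ _ (ih _ u v huv)
        rintro a b ⟨hab, hua, hub⟩
        refine ⟨h.mono hab (le_of_eq (by push_cast; ring)), h.trans' hxu hua ?_ ?_,
          h.trans' hxu hub ?_ ?_⟩ <;> omega
      clear ih hxy first
      induction h1 with
      | refl => exact .refl
      | tail _ hbc ih => exact ih.trans (h2 _ _ hbc)
  refine ⟨c * N + c, by omega, fun m x y hxy n => ?_⟩
  refine Relation.ReflTransGen.mono ?_ _ _ (iter (n - m).toNat m x y hxy)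
  rintro u v ⟨huv, h1, h2⟩
  refine ⟨h.mono huv ?_, h1, h2⟩
  have : ((n - m).toNat : ℤ) ≤ (n - m).toNat * (c + 1) :=
    le_mul_of_one_le_right (by positivity) (by omega)
  have := Int.self_le_toNat (n - m)
  omega

end IsLogScale

namespace ProductScales

theorem swap (h : ProductScales E F c) : ProductScales F E c where
  fst := h.snd
  snd := h.fst
  sep := fun h₁ h₂ hn => h.sep h₂ h₁ (by omega)
  prod := fun h₁ h₂ hn => (h.prod h₂ h₁ (by omega)).imp fun _ hw => hw.symm

/-- The fourth corner of a rectangle is unique. -/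
theorem corner_unique (h : ProductScales E F c) {n m : ℤ} {x y w w' : X} (h₁ : E n y w)
    (h₂ : E n y w') (h₃ : F m x w) (h₄ : F m x w') (hnm : 2 * c ≤ n + m) : w = w' :=
  h.sep (h.fst.trans (h.fst.symm h₁) h₂) (h.snd.trans (h.snd.symm h₃) h₄) (by omega)

/-- Opposite sides of a rectangle have the same log-scale up to an additive constant: if a bound
`n'` for the side `p p'` is known that guarantees that the rectangle is unique, then it can be
improved to the log-scale `n` of the side `x x'`, minus the constant `c`. -/
theorem corner_transfer (h : ProductScales E F c) {n n' m : ℤ} {x x' p p' : X} (h₁ : E n x x')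
    (h₂ : F m x p) (h₃ : F m x' p') (h₄ : E n' p p') (hn : n' ≤ n) (hnm : 4 * c ≤ n' + m) :
    E (n - c) p p' := by
  have hc := h.fst.nonneg
  obtain ⟨z, hz₁, hz₂⟩ := h.prod h₁ h₂ (by omega)
  have : z = p' := h.corner_unique (n := n' - c) (m := m - c) (h.fst.mono hz₂ (by omega))
    (h.fst.mono h₄ (by omega)) hz₁ (h.snd.mono h₃ (by omega)) (by omega)
  rwa [this] at hz₂

/-- Two maps `G`, `G'` on `A × B` that respect the scales in each of the variables, and agree on
`{a₀} × B` and on `A × {b₀}`, agree at every `(a, b)` that can be reached from `(a₀, b₀)` by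
arbitrarily fine chains: the fourth corners of small rectangles are unique. -/
theorem eq_of_chains (h : ProductScales E F c) {A B : Set X} {G G' : X → X → X} {a₀ b₀ a b : X}
    {S : ℤ}
    (hG : ∀ a ∈ A, ∀ a' ∈ A, ∀ b ∈ B, ∀ b' ∈ B,
      (E S a a' → E c (G a b) (G a' b)) ∧ (F S b b' → F c (G a b) (G a b')))
    (hG' : ∀ a ∈ A, ∀ a' ∈ A, ∀ b ∈ B, ∀ b' ∈ B,
      (E S a a' → E c (G' a b) (G' a' b)) ∧ (F S b b' → F c (G' a b) (G' a b')))
    (ha₀ : a₀ ∈ A) (hb₀ : b₀ ∈ B)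
    (hl : ∀ b ∈ B, G a₀ b = G' a₀ b) (hr : ∀ a ∈ A, G a b₀ = G' a b₀)
    (ha : Relation.ReflTransGen (fun u v => E S u v ∧ v ∈ A) a₀ a)
    (hb : Relation.ReflTransGen (fun u v => F S u v ∧ v ∈ B) b₀ b) : G a b = G' a b := by
  suffices a ∈ A ∧ ∀ b, Relation.ReflTransGen (fun u v => F S u v ∧ v ∈ B) b₀ b →
      b ∈ B ∧ G a b = G' a b from (this.2 b hb).2
  clear hb
  induction ha with
  | refl =>
    refine ⟨ha₀, fun b hb => ?_⟩
    have : b ∈ B := by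
      induction hb with
      | refl => exact hb₀
      | tail _ h _ => exact h.2
    exact ⟨this, hl b this⟩
  | @tail a a' _ haa ih =>
    obtain ⟨haA, ih⟩ := ih
    refine ⟨haa.2, fun b hb => ?_⟩
    induction hb with
    | refl => exact ⟨hb₀, hr _ haa.2⟩
    | @tail b b' hb hbb ihb =>
      refine ⟨hbb.2, ?_⟩
      have hbB := ihb.1
      have e := (ih b' (hb.tail hbb)).2
      -- Both `G a' b'` and `G' a' b'` are the fourth corner of the small rectangle with the corners
      -- `G a b`, `G a b'` and `G a' b`.
      have g₁ := (hG a haA a' haa.2 b' hbb.2 b' hbb.2).1 haa.1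
      have g₂ := (hG a' haa.2 a' haa.2 b hbB b' hbb.2).2 hbb.1
      have g₃ := (hG' a haA a' haa.2 b' hbb.2 b' hbb.2).1 haa.1
      have g₄ := (hG' a' haa.2 a' haa.2 b hbB b' hbb.2).2 hbb.1
      rw [← e] at g₃
      rw [← ihb.2] at g₄
      exact h.corner_unique g₁ g₃ g₂ g₄ (by omega)

end ProductScales
end

noncomputable section

variable {X : Type*} {E F : ℤ → X → X → Prop} {c : ℤ}

/-! ### Existence of the holonomy on bounded pieces of leaves -/

/-- A row over a set `A` of points stably equivalent to `x₀`: the holonomy `g : A → X` along a chain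
of `j` steps of unstable log-scale `s` from `x₀` to `u`.  It maps `A` into the ball of stable
log-scale `N` of `u`, and points of stable log-scale `t` to points of log-scale `t - c`. -/
structure IsRow (E F : ℤ → X → X → Prop) (c : ℤ) (A : Set X) (N s t : ℤ) (x₀ : X) (j : ℕ) (u : X)
    (g : X → X) : Prop where
  base : g x₀ = u
  chain : ∀ a ∈ A, StepChain (F (s - c)) j a (g a)
  near : ∀ a ∈ A, E N u (g a)
  side : ∀ a ∈ A, ∀ a' ∈ A, E t a a' → E (t - c) (g a) (g a')

/-- `P` is the holonomy `(a, b) ↦ [a, b]` of the leaves of `x₀` on the balls of log-scale `n`: a map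
that is the identity on the axes, moves points by a bounded distance, and is uniformly continuous in
each of the variables. -/
structure IsHolonomyOn (E F : ℤ → X → X → Prop) (x₀ : X) (n : ℤ) (P : X → X → X) : Prop where
  base_left : ∀ b, F n x₀ b → P x₀ b = b
  base_right : ∀ a, E n x₀ a → P a x₀ = a
  bdd : ∃ H, ∀ a b, E n x₀ a → F n x₀ b → E H b (P a b) ∧ F H a (P a b)
  cont_left : ∀ N, ∃ S, ∀ a a' b, E n x₀ a → E n x₀ a' → F n x₀ b → E S a a' →
    E N (P a b) (P a' b)
  cont_right : ∀ N, ∃ S, ∀ a b b', E n x₀ a → F n x₀ b → F n x₀ b' → F S b b' →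
    F N (P a b) (P a b')

/-- The choice of the scales of the chains, where the pinching condition is used: there are
`s = λσ` and `t = λτ` with `σ + τ = 1` and `1 - β₀ / β₁ < τ < α₀ / α₁`, and a big `λ`. -/
theorem exists_scales_of_pinching {α₀ α₁ β₀ β₁ : ℝ} (hα₀ : 0 < α₀) (hα₁ : 0 < α₁)
    (hβ₀ : 0 < β₀) (hβ₁ : 0 < β₁) (hp : 1 < α₀ / α₁ + β₀ / β₁) (D : ℝ) :
    ∃ s t : ℤ, D ≤ s ∧ D ≤ t ∧ α₁ * t + D < α₀ * (s + t) ∧ β₁ * s + D < β₀ * (s + t) := by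
  have h₁ : 0 < α₀ / α₁ := by positivity
  have h₂ : 0 < β₀ / β₁ := by positivity
  obtain ⟨τ, hτ₁, hτ₂⟩ : ∃ τ, max 0 (1 - β₀ / β₁) < τ ∧ τ < min 1 (α₀ / α₁) := by
    apply exists_between
    simp only [max_lt_iff, lt_min_iff]
    exact ⟨⟨one_pos, by linarith⟩, h₁, by linarith⟩
  rw [max_lt_iff] at hτ₁
  rw [lt_min_iff] at hτ₂
  have hA : 0 < α₀ - α₁ * τ := by
    have := (lt_div_iff₀ hα₁).1 hτ₂.2
    linarith
  have hB : 0 < β₀ - β₁ * (1 - τ) := by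
    have : 1 - τ < β₀ / β₁ := by linarith
    have := (lt_div_iff₀ hβ₁).1 this
    linarith
  have hσ : 0 < 1 - τ := by linarith
  obtain ⟨l, hl⟩ := exists_gt (max (max (D / τ) (D / (1 - τ)))
    (max ((α₁ + D) / (α₀ - α₁ * τ)) ((β₁ + D) / (β₀ - β₁ * (1 - τ)))))
  simp only [max_lt_iff] at hl
  obtain ⟨⟨l₁, l₂⟩, l₃, l₄⟩ := hl
  rw [div_lt_iff₀ hτ₁.1] at l₁
  rw [div_lt_iff₀ hσ] at l₂
  rw [div_lt_iff₀ hA] at l₃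
  rw [div_lt_iff₀ hB] at l₄
  · have c₁ := Int.le_ceil (l * (1 - τ))
    have c₂ := Int.le_ceil (l * τ)
    have c₃ := Int.ceil_lt_add_one (l * (1 - τ))
    have c₄ := Int.ceil_lt_add_one (l * τ)
    refine ⟨⌈l * (1 - τ)⌉, ⌈l * τ⌉, by linarith, by linarith, ?_, ?_⟩
    · have e₁ : α₁ * (⌈l * τ⌉ : ℝ) < α₁ * (l * τ + 1) := by gcongr
      have e₂ : α₀ * l ≤ α₀ * ((⌈l * (1 - τ)⌉ : ℝ) + ⌈l * τ⌉) := by gcongr; linarith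
      linarith
    · have e₁ : β₁ * (⌈l * (1 - τ)⌉ : ℝ) < β₁ * (l * (1 - τ) + 1) := by gcongr
      have e₂ : β₀ * l ≤ β₀ * ((⌈l * (1 - τ)⌉ : ℝ) + ⌈l * τ⌉) := by gcongr; linarith
      linarith

namespace ProductScales

/-- A row can be continued by one step of the unstable chain.  The a priori bounds `hE` and `hF`
keep the sides of the rows and columns from growing: a row is a chain of at most `K` stable steps,
and a column is a chain of at most `J` unstable steps. -/
theorem exists_next_row (h : ProductScales E F c) {N M s t : ℤ} {K J : ℕ} {x₀ : X}
    (hN : 7 * c ≤ N + s) (hM : 7 * c ≤ M + t) (hNt : N ≤ t)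
    (hE : ∀ k ≤ K, ∀ x y, StepChain (E (t - c)) k x y → E N x y)
    (hF : ∀ j ≤ J, ∀ x y, StepChain (F (s - c)) j x y → F M x y)
    {j : ℕ} (hj : j + 1 ≤ J) {u u' : X} {g : X → X}
    (hg : IsRow E F c {a | ∃ k ≤ K, StepChain (E t) k x₀ a} N s t x₀ j u g) (hu : F s u u') :
    ∃ g', IsRow E F c {a | ∃ k ≤ K, StepChain (E t) k x₀ a} N s t x₀ (j + 1) u' g' ∧
      ∀ a, (∃ k ≤ K, StepChain (E t) k x₀ a) → F (s - c) (g a) (g' a) := by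
  have hc := h.fst.nonneg
  have ex : ∀ a, ∃ w, (∃ k ≤ K, StepChain (E t) k x₀ a) →
      F (s - c) (g a) w ∧ E (N - c) u' w := by
    intro a
    by_cases ha : ∃ k ≤ K, StepChain (E t) k x₀ a
    · obtain ⟨w, hw⟩ := h.prod (hg.near a ha) hu (by omega)
      exact ⟨w, fun _ => hw⟩
    · exact ⟨a, fun ha' => absurd ha' ha⟩
  choose g' hg' using ex
  have hx₀ : ∃ k ≤ K, StepChain (E t) k x₀ x₀ := ⟨0, by omega, rfl⟩
  have base : g' x₀ = u' := by
    obtain ⟨h₁, h₂⟩ := hg' x₀ hx₀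
    rw [hg.base] at h₁
    exact h.corner_unique h₂ (h.fst.refl _ _) h₁ (h.snd.mono hu (by omega)) (by omega)
  have chain : ∀ a ∈ {a | ∃ k ≤ K, StepChain (E t) k x₀ a},
      StepChain (F (s - c)) (j + 1) a (g' a) :=
    fun a ha => ⟨g a, hg.chain a ha, (hg' a ha).1⟩
  have side : ∀ a ∈ {a | ∃ k ≤ K, StepChain (E t) k x₀ a},
      ∀ a' ∈ {a | ∃ k ≤ K, StepChain (E t) k x₀ a}, E t a a' → E (t - c) (g' a) (g' a') := by
    intro a ha a' ha' haa
    -- The image of the side `a a'` is bounded in terms of `N` only.  This is improved by transfer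
    -- from the previous row, and then by transfer from the row `A` itself along whole columns, so
    -- the constant does not grow with the number of rows.
    have crude : E (N - 2 * c) (g' a) (g' a') :=
      h.fst.mono (h.fst.trans (h.fst.symm (hg' a ha).2) (hg' a' ha').2) (by omega)
    have h₁ := h.corner_transfer (hg.side a ha a' ha' haa) (hg' a ha).1 (hg' a' ha').1 crude
      (by omega) (by omega)
    exact h.corner_transfer haa (hF _ hj _ _ (chain a ha)) (hF _ hj _ _ (chain a' ha')) h₁
      (by omega) (by omega)
  refine ⟨g', ⟨base, chain, ?_, side⟩, fun a ha => (hg' a ha).1⟩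
  have img : ∀ k ≤ K, ∀ a, StepChain (E t) k x₀ a → StepChain (E (t - c)) k u' (g' a) := by
    intro k
    induction k with
    | zero => rintro - a rfl; exact base.symm
    | succ k ih =>
      rintro hk a ⟨w, hw, hwa⟩
      exact ⟨g' w, ih (by omega) w hw, side w ⟨k, by omega, hw⟩ a ⟨k + 1, hk, w, hw, hwa⟩ hwa⟩
  rintro a ⟨k, hk, ha⟩
  exact hE k hk _ _ (img k hk a ha)

/-- A row does not depend on the unstable chain along which it was continued. -/
theorem row_unique (h : ProductScales E F c) {N M s t : ℤ} {K J : ℕ} {x₀ : X}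
    (hM : 7 * c ≤ M + t)
    (hF : ∀ j ≤ J, ∀ x y, StepChain (F (s - c)) j x y → F M x y)
    {j j' : ℕ} (hj : j ≤ J) (hj' : j' ≤ J) {u : X} {g g' : X → X}
    (hg : IsRow E F c {a | ∃ k ≤ K, StepChain (E t) k x₀ a} N s t x₀ j u g)
    (hg' : IsRow E F c {a | ∃ k ≤ K, StepChain (E t) k x₀ a} N s t x₀ j' u g') :
    ∀ a, (∃ k ≤ K, StepChain (E t) k x₀ a) → g a = g' a := by
  have hc := h.fst.nonneg
  rintro a ⟨k, hk, ha⟩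
  induction k generalizing a with
  | zero => cases ha; rw [hg.base, hg'.base]
  | succ k ih =>
    obtain ⟨w, hw, hwa⟩ := ha
    have haA : a ∈ {a | ∃ k ≤ K, StepChain (E t) k x₀ a} := ⟨k + 1, hk, w, hw, hwa⟩
    have hwA : w ∈ {a | ∃ k ≤ K, StepChain (E t) k x₀ a} := ⟨k, by omega, hw⟩
    have h₁ := hg.side w hwA a haA hwa
    have h₂ := hg'.side w hwA a haA hwa
    rw [← ih w (by omega) hw] at h₂
    exact h.corner_unique h₁ h₂ (hF j hj _ _ (hg.chain a haA)) (hF j' hj' _ _ (hg'.chain a haA))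
      (by omega)

/-- The a priori bounds `hE`, `hF` for the rows and columns imply the existence of the holonomy.
The columns may have one more step than needed in `hFn`: the continuity in the unstable direction is
proved by adding a step to a column. -/
theorem isHolonomyOn_of_bounds (h : ProductScales E F c) {N M s t n : ℤ} {K J : ℕ} {x₀ : X}
    (hN : 7 * c ≤ N + s) (hM : 7 * c ≤ M + t) (hNt : N ≤ t)
    (hE : ∀ k ≤ K, ∀ x y, StepChain (E (t - c)) k x y → E N x y)
    (hF : ∀ j ≤ J, ∀ x y, StepChain (F (s - c)) j x y → F M x y)
    (hEn : ∀ a, E n x₀ a → ∃ k ≤ K, StepChain (E t) k x₀ a)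
    (hFn : ∀ b, F n x₀ b → ∃ j, j + 1 ≤ J ∧ StepChain (F s) j x₀ b) :
    ∃ P, IsHolonomyOn E F x₀ n P := by
  have hc := h.fst.nonneg
  set A : Set X := {a | ∃ k ≤ K, StepChain (E t) k x₀ a} with hA
  have hx₀ : x₀ ∈ A := ⟨0, by omega, rfl⟩
  have row₀ : IsRow E F c A N s t x₀ 0 x₀ id := by
    refine ⟨rfl, fun a _ => rfl, ?_, fun a _ a' _ haa => h.fst.mono haa (by omega)⟩
    rintro a ⟨k, hk, ha⟩
    refine hE k hk _ _ ?_
    clear hk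
    induction k generalizing a with
    | zero => exact ha
    | succ k ih =>
      obtain ⟨w, hw, hwa⟩ := ha
      exact ⟨w, ih w hw, h.fst.mono hwa (by omega)⟩
  have rows : ∀ j ≤ J, ∀ b, StepChain (F s) j x₀ b → ∃ g, IsRow E F c A N s t x₀ j b g := by
    intro j
    induction j with
    | zero => rintro - b rfl; exact ⟨id, row₀⟩
    | succ j ih =>
      rintro hj b ⟨w, hw, hwb⟩
      obtain ⟨g, hg⟩ := ih (by omega) w hw
      obtain ⟨g', hg', -⟩ := h.exists_next_row hN hM hNt hE hF hj hg hwb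
      exact ⟨g', hg'⟩
  have ex : ∀ b, ∃ g : X → X, F n x₀ b → ∃ j, j + 1 ≤ J ∧ IsRow E F c A N s t x₀ j b g := by
    intro b
    by_cases hb : F n x₀ b
    · obtain ⟨j, hj, hjb⟩ := hFn b hb
      obtain ⟨g, hg⟩ := rows j (by omega) b hjb
      exact ⟨g, fun _ => ⟨j, hj, hg⟩⟩
    · exact ⟨id, fun hb' => absurd hb' hb⟩
  choose g hg using ex
  have hcol : ∀ a ∈ A, ∀ b, F n x₀ b → F M a (g b a) := by
    intro a ha b hb
    obtain ⟨j, hj, hrow⟩ := hg b hb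
    exact hF j (by omega) _ _ (hrow.chain a ha)
  have hnear : ∀ a ∈ A, ∀ b, F n x₀ b → E N b (g b a) := by
    intro a ha b hb
    obtain ⟨j, hj, hrow⟩ := hg b hb
    exact hrow.near a ha
  refine ⟨fun a b => g b a, ?_, ?_, ?_, ?_, ?_⟩
  · intro b hb
    obtain ⟨j, hj, hrow⟩ := hg b hb
    exact hrow.base
  · intro a ha
    obtain ⟨j, hj, hrow⟩ := hg x₀ (h.snd.refl _ _)
    exact h.row_unique hM hF (by omega) (Nat.zero_le _) hrow row₀ a (hEn a ha)
  · refine ⟨min N M, fun a b ha hb => ⟨?_, ?_⟩⟩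
    · exact h.fst.mono (hnear a (hEn a ha) b hb) (by omega)
    · exact h.snd.mono (hcol a (hEn a ha) b hb) (by omega)
  · refine fun N₀ => ⟨max t (N₀ + c), fun a a' b ha ha' hb haa => ?_⟩
    obtain ⟨j, hj, hrow⟩ := hg b hb
    have := hrow.side a (hEn a ha) a' (hEn a' ha') (h.fst.mono haa (by omega))
    exact h.fst.mono (h.corner_transfer haa (hcol a (hEn a ha) b hb) (hcol a' (hEn a' ha') b hb)
      this (by omega) (by omega)) (by omega)
  · refine fun N₀ => ⟨max s (N₀ + c), fun a b b' ha hb hb' hbb => ?_⟩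
    obtain ⟨j, hj, hrow⟩ := hg b hb
    obtain ⟨j', hj', hrow'⟩ := hg b' hb'
    obtain ⟨g', hg', hgg⟩ := h.exists_next_row hN hM hNt hE hF hj hrow
      (h.snd.mono hbb (by omega))
    have := hgg a (hEn a ha)
    rw [h.row_unique hM hF hj (by omega) hg' hrow' a (hEn a ha)] at this
    exact h.snd.mono (h.swap.corner_transfer hbb (hnear a (hEn a ha) b hb)
      (hnear a (hEn a ha) b' hb') this (by omega) (by omega)) (by omega)

/-- Under the pinching condition, the holonomy exists on arbitrarily big pieces of the leaves: by
the upper exponents, about `exp (α₁ t)` and `exp (β₁ s)` steps are needed in the stable and the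
unstable direction, and by the lower exponents, as long as these are less than `exp (α₀ (s + t))`
and `exp (β₀ (s + t))`, such chains connect points of log-scales at least `-s` and `-t`, up to
constants.  A step of log-scale `s` and a side of log-scale `-s` still span a rectangle. -/
theorem exists_isHolonomyOn (h : ProductScales E F c) {α₀ α₁ β₀ β₁ A₀ A₁ B₀ B₁ : ℝ}
    (hα₀ : 0 < α₀) (hα₁ : 0 < α₁) (hβ₀ : 0 < β₀) (hβ₁ : 0 < β₁)
    (hA₀ : 0 < A₀) (hA₁ : 0 < A₁) (hB₀ : 0 < B₀) (hB₁ : 0 < B₁)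
    (hE₀ : LowerExp E α₀ A₀) (hE₁ : UpperExp E α₁ A₁)
    (hF₀ : LowerExp F β₀ B₀) (hF₁ : UpperExp F β₁ B₁)
    (hp : 1 < α₀ / α₁ + β₀ / β₁) (x₀ : X) (n : ℤ) : ∃ P, IsHolonomyOn E F x₀ n P := by
  have hc := h.fst.nonneg
  set D₁ : ℝ := Real.log A₁ - Real.log A₀ - α₁ * n + α₀ * (8 * c) with hD₁
  set D₂ : ℝ := Real.log (B₁ + 1) - Real.log B₀ - β₁ * n + β₀ * (8 * c) with hD₂
  obtain ⟨s, t, hs, ht, hst₁, hst₂⟩ :=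
    exists_scales_of_pinching hα₀ hα₁ hβ₀ hβ₁ hp (max (max D₁ D₂) (max n (7 * c)))
  simp only [max_le_iff] at hs ht
  have hs₁ : n ≤ s := by exact_mod_cast hs.2.1
  have hs₂ : 7 * c ≤ s := by exact_mod_cast hs.2.2
  have ht₁ : n ≤ t := by exact_mod_cast ht.2.1
  have ht₂ : 7 * c ≤ t := by exact_mod_cast ht.2.2
  have hD₁' := (le_max_left D₁ D₂).trans (le_max_left (max D₁ D₂) (max (n : ℝ) (7 * c)))
  have hD₂' := (le_max_right D₁ D₂).trans (le_max_left (max D₁ D₂) (max (n : ℝ) (7 * c)))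
  -- The number of steps that a priori suffices for the balls of log-scale `n`.
  have bound₁ : A₁ * Real.exp (α₁ * (t - n)) <
      A₀ * Real.exp (α₀ * (((t - c : ℤ) : ℝ) - ((7 * c - s : ℤ) : ℝ))) := by
    rw [← Real.exp_log hA₁, ← Real.exp_log hA₀, ← Real.exp_add, ← Real.exp_add, Real.exp_lt_exp]
    push_cast
    linarith
  have bound₂ : B₁ * Real.exp (β₁ * (s - n)) + 1 <
      B₀ * Real.exp (β₀ * (((s - c : ℤ) : ℝ) - ((7 * c - t : ℤ) : ℝ))) := by
    have h1 : 1 ≤ Real.exp (β₁ * (s - n)) := by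
      apply Real.one_le_exp
      have : (n : ℝ) ≤ s := by exact_mod_cast hs₁
      nlinarith
    have h2 : (B₁ + 1) * Real.exp (β₁ * (s - n)) <
        B₀ * Real.exp (β₀ * (((s - c : ℤ) : ℝ) - ((7 * c - t : ℤ) : ℝ))) := by
      rw [← Real.exp_log (by positivity : 0 < B₁ + 1), ← Real.exp_log hB₀, ← Real.exp_add,
        ← Real.exp_add, Real.exp_lt_exp]
      push_cast
      linarith
    linarith
  refine h.isHolonomyOn_of_bounds (N := 7 * c - s) (M := 7 * c - t) (s := s) (t := t)
    (K := ⌊A₁ * Real.exp (α₁ * (t - n))⌋₊) (J := ⌊B₁ * Real.exp (β₁ * (s - n))⌋₊ + 1)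
    (by omega) (by omega) (by omega) ?_ ?_ ?_ ?_
  · intro k hk x y hxy
    refine hE₀ _ _ k x y hxy (lt_of_le_of_lt ?_ bound₁)
    exact (Nat.le_floor_iff (by positivity)).1 hk
  · intro k hk x y hxy
    refine hF₀ _ _ k x y hxy (lt_of_le_of_lt ?_ bound₂)
    have : ((⌊B₁ * Real.exp (β₁ * (s - n))⌋₊ : ℕ) : ℝ) ≤ B₁ * Real.exp (β₁ * (s - n)) :=
      Nat.floor_le (by positivity)
    have hk' : (k : ℝ) ≤ (⌊B₁ * Real.exp (β₁ * (s - n))⌋₊ + 1 : ℕ) := by exact_mod_cast hk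
    push_cast at hk'
    linarith
  · intro a ha
    obtain ⟨k, hk, hka⟩ := hE₁ n t x₀ a ht₁ ha
    exact ⟨k, Nat.le_floor hk, hka⟩
  · intro b hb
    obtain ⟨k, hk, hkb⟩ := hF₁ n s x₀ b hs₁ hb
    exact ⟨k, Nat.succ_le_succ (Nat.le_floor hk), hkb⟩

end ProductScales
end

noncomputable section

variable {X : Type*} {E F : ℤ → X → X → Prop} {c : ℤ}

/-! ### The global holonomy, and the change of its base point -/

/-- `P` is the holonomy `(a, b) ↦ [a, b]` of the leaves of `x₀`. -/
def IsHolonomy (E F : ℤ → X → X → Prop) (x₀ : X) (P : X → X → X) : Prop :=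
  ∀ n, IsHolonomyOn E F x₀ n P

theorem HasFineChains.mono (hE : IsLogScale E c) {D D' : ℤ} (h : HasFineChains E D)
    (hD : D ≤ D') : HasFineChains E D' := by
  refine ⟨h.1.trans hD, fun m x y hxy n => Relation.ReflTransGen.mono ?_ _ _ (h.2 m x y hxy n)⟩
  rintro u v ⟨h₁, h₂, h₃⟩
  exact ⟨h₁, hE.mono h₂ (by omega), hE.mono h₃ (by omega)⟩

namespace IsHolonomyOn

variable {x₀ : X} {n : ℤ} {P : X → X → X}

theorem swap (h : IsHolonomyOn E F x₀ n P) : IsHolonomyOn F E x₀ n (fun b a => P a b) where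
  base_left := h.base_right
  base_right := h.base_left
  bdd := h.bdd.imp fun _ hH b a hb ha => (hH a b ha hb).symm
  cont_left := fun N => (h.cont_right N).imp fun _ hS b b' a hb hb' ha hbb =>
    hS a b b' ha hb hb' hbb
  cont_right := fun N => (h.cont_left N).imp fun _ hS b a a' hb ha ha' haa =>
    hS a a' b ha ha' hb haa

theorem mono (hEF : ProductScales E F c) (h : IsHolonomyOn E F x₀ n P) {m : ℤ} (hnm : n ≤ m) :
    IsHolonomyOn E F x₀ m P := by
  have hE : ∀ {a}, E m x₀ a → E n x₀ a := fun ha => hEF.fst.mono ha hnm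
  have hF : ∀ {a}, F m x₀ a → F n x₀ a := fun ha => hEF.snd.mono ha hnm
  exact
  { base_left := fun b hb => h.base_left b (hF hb)
    base_right := fun a ha => h.base_right a (hE ha)
    bdd := h.bdd.imp fun _ hH a b ha hb => hH a b (hE ha) (hF hb)
    cont_left := fun N => (h.cont_left N).imp fun _ hS a a' b ha ha' hb =>
      hS a a' b (hE ha) (hE ha') (hF hb)
    cont_right := fun N => (h.cont_right N).imp fun _ hS a b b' ha hb hb' =>
      hS a b b' (hE ha) (hF hb) (hF hb') }

theorem congr (hEF : ProductScales E F c) (h : IsHolonomyOn E F x₀ n P) {P' : X → X → X}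
    (hP : ∀ a b, E n x₀ a → F n x₀ b → P' a b = P a b) : IsHolonomyOn E F x₀ n P' where
  base_left := fun b hb => (hP _ _ (hEF.fst.refl _ _) hb).trans (h.base_left b hb)
  base_right := fun a ha => (hP _ _ ha (hEF.snd.refl _ _)).trans (h.base_right a ha)
  bdd := h.bdd.imp fun _ hH a b ha hb => by rw [hP a b ha hb]; exact hH a b ha hb
  cont_left := fun N => (h.cont_left N).imp fun _ hS a a' b ha ha' hb => by
    rw [hP a b ha hb, hP a' b ha' hb]; exact hS a a' b ha ha' hb
  cont_right := fun N => (h.cont_right N).imp fun _ hS a b b' ha hb hb' => by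
    rw [hP a b ha hb, hP a b' ha hb']; exact hS a b b' ha hb hb'

/-- Two holonomies agree, since both are the identity on the axes. -/
theorem unique (hEF : ProductScales E F c) {D : ℤ} (hDE : HasFineChains E D)
    (hDF : HasFineChains F D) {P' : X → X → X} (h : IsHolonomyOn E F x₀ n P)
    (h' : IsHolonomyOn E F x₀ n P') {a b : X} (ha : E (n + D) x₀ a) (hb : F (n + D) x₀ b) :
    P a b = P' a b := by
  obtain ⟨S₁, h₁⟩ := h.cont_left c
  obtain ⟨S₂, h₂⟩ := h.cont_right c
  obtain ⟨S₃, h₃⟩ := h'.cont_left c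
  obtain ⟨S₄, h₄⟩ := h'.cont_right c
  set S := max (max S₁ S₂) (max S₃ S₄)
  have hE₀ : E n x₀ x₀ := hEF.fst.refl _ _
  have hF₀ : F n x₀ x₀ := hEF.snd.refl _ _
  refine hEF.eq_of_chains (A := {a | E n x₀ a}) (B := {b | F n x₀ b}) (S := S) ?_ ?_ hE₀ hF₀ ?_ ?_
    (Relation.ReflTransGen.mono ?_ _ _ (hDE.2 _ _ _ ha S))
    (Relation.ReflTransGen.mono ?_ _ _ (hDF.2 _ _ _ hb S))
  · exact fun a ha a' ha' b hb b' hb' =>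
      ⟨fun haa => h₁ a a' b ha ha' hb (hEF.fst.mono haa (by omega)),
        fun hbb => h₂ a b b' ha hb hb' (hEF.snd.mono hbb (by omega))⟩
  · exact fun a ha a' ha' b hb b' hb' =>
      ⟨fun haa => h₃ a a' b ha ha' hb (hEF.fst.mono haa (by omega)),
        fun hbb => h₄ a b b' ha hb hb' (hEF.snd.mono hbb (by omega))⟩
  · exact fun b hb => (h.base_left b hb).trans (h'.base_left b hb).symm
  · exact fun a ha => (h.base_right a ha).trans (h'.base_right a ha).symm
  · rintro u v ⟨h₁, -, h₂⟩
    exact ⟨h₁, hEF.fst.mono h₂ (by omega)⟩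
  · rintro u v ⟨h₁, -, h₂⟩
    exact ⟨h₁, hEF.snd.mono h₂ (by omega)⟩

end IsHolonomyOn

/-- The holonomies of bounded pieces of leaves fit together. -/
theorem exists_isHolonomy (hEF : ProductScales E F c) {D : ℤ} (hDE : HasFineChains E D)
    (hDF : HasFineChains F D) {x₀ : X} (h : ∀ n, ∃ P, IsHolonomyOn E F x₀ n P) :
    ∃ P, IsHolonomy E F x₀ P := by
  choose Q hQ using h
  have ex : ∀ a b, ∃ z, ∀ n, E (n + D) x₀ a → F (n + D) x₀ b → z = Q n a b := by
    intro a b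
    by_cases hab : ∃ n, E (n + D) x₀ a ∧ F (n + D) x₀ b
    · obtain ⟨n, ha, hb⟩ := hab
      refine ⟨Q n a b, fun m ha' hb' => ?_⟩
      rcases le_total n m with hnm | hnm
      · exact ((hQ n).mono hEF hnm).unique hEF hDE hDF (hQ m) ha' hb'
      · exact (hQ n).unique hEF hDE hDF ((hQ m).mono hEF hnm) ha hb
    · exact ⟨a, fun n ha hb => absurd ⟨n, ha, hb⟩ hab⟩
  choose P hP using ex
  have hD := hDE.1
  refine ⟨P, fun n => ((hQ (n - D)).mono hEF (by omega)).congr hEF fun a b ha hb => ?_⟩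
  exact hP a b (n - D) (by rwa [sub_add_cancel]) (by rwa [sub_add_cancel])

namespace IsHolonomy

variable {x₀ : X} {P P' : X → X → X}

theorem swap (h : IsHolonomy E F x₀ P) : IsHolonomy F E x₀ (fun b a => P a b) :=
  fun n => (h n).swap

theorem base_left (h : IsHolonomy E F x₀ P) {n : ℤ} {b : X} (hb : F n x₀ b) : P x₀ b = b :=
  (h n).base_left b hb

theorem base_right (h : IsHolonomy E F x₀ P) {n : ℤ} {a : X} (ha : E n x₀ a) : P a x₀ = a :=
  (h n).base_right a ha

/-- The change of the base point along the stable leaf.  Both sides are equal to `P x b` for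
`a = x`, and to `a` for `b = x₀`. -/
theorem base_change (hEF : ProductScales E F c) {D : ℤ} (hDE : HasFineChains E D)
    (hDF : HasFineChains F D) {x : X} (h : IsHolonomy E F x₀ P) (h' : IsHolonomy E F x P')
    {n₁ n₂ n₃ : ℤ} (hx : E n₁ x₀ x) {a b : X} (ha : E n₂ x₀ a) (hb : F n₃ x₀ b) :
    P' a (P x b) = P a b := by
  have hc := hEF.fst.nonneg
  have hD := hDE.1
  obtain ⟨n, hn₁, hn₂, hn₃⟩ : ∃ n, n ≤ n₁ ∧ n ≤ n₂ ∧ n ≤ n₃ :=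
    ⟨min n₁ (min n₂ n₃), by omega, by omega, by omega⟩
  replace hx := hEF.fst.mono hx hn₁
  replace ha := hEF.fst.mono ha hn₂
  replace hb := hEF.snd.mono hb hn₃
  obtain ⟨N, hN⟩ : ∃ N, N = n - 2 * c - D := ⟨_, rfl⟩
  obtain ⟨H, hH⟩ := (h N).bdd
  obtain ⟨N', hN'⟩ : ∃ N', N' = min (N - c) H := ⟨_, rfl⟩
  obtain ⟨S₁, h₁⟩ := (h N).cont_left c
  obtain ⟨S₂, h₂⟩ := (h N).cont_right c
  obtain ⟨S₃, h₃⟩ := (h' N').cont_left c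
  obtain ⟨S₄, h₄⟩ := (h' N').cont_right c
  obtain ⟨S₅, h₅⟩ := (h N).cont_right S₄
  set S := max S₅ (max (max S₁ S₂) (max S₃ S₄))
  have hxN : E N x₀ x := hEF.fst.mono hx (by omega)
  have hE' : ∀ {a}, E N x₀ a → E N' x a := fun ha =>
    hEF.fst.mono (hEF.fst.trans (hEF.fst.symm hxN) ha) (by omega)
  have hF' : ∀ {b}, F N x₀ b → F N' x (P x b) := fun hb =>
    hEF.snd.mono (hH _ _ hxN hb).2 (by omega)
  refine hEF.eq_of_chains (A := {a | E N x₀ a}) (B := {b | F N x₀ b}) (S := S)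
    (G := fun a b => P' a (P x b)) (G' := P) ?_ ?_ hxN (hEF.snd.refl _ _) ?_ ?_
    (Relation.ReflTransGen.mono ?_ _ _
      (hDE.2 _ _ _ (hEF.fst.trans (hEF.fst.symm hx) ha) S))
    (Relation.ReflTransGen.mono ?_ _ _ (hDF.2 _ _ _ hb S))
  · exact fun a ha a' ha' b hb b' hb' =>
      ⟨fun haa => h₃ a a' _ (hE' ha) (hE' ha') (hF' hb) (hEF.fst.mono haa (by omega)),
        fun hbb => h₄ a _ _ (hE' ha) (hF' hb) (hF' hb')
          (h₅ x b b' hxN hb hb' (hEF.snd.mono hbb (by omega)))⟩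
  · exact fun a ha a' ha' b hb b' hb' =>
      ⟨fun haa => h₁ a a' b ha ha' hb (hEF.fst.mono haa (by omega)),
        fun hbb => h₂ a b b' ha hb hb' (hEF.snd.mono hbb (by omega))⟩
  · exact fun b hb => h'.base_left (hF' hb)
  · intro a ha
    rw [h.base_right hxN, h.base_right ha, h'.base_right (hE' ha)]
  · rintro u v ⟨h₁, -, h₂⟩
    exact ⟨h₁, hEF.fst.trans' hx h₂ (by omega) (by omega)⟩
  · rintro u v ⟨h₁, -, h₂⟩
    exact ⟨h₁, hEF.snd.mono h₂ (by omega)⟩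

end IsHolonomy
end

noncomputable section

variable {X : Type*} {E F : ℤ → X → X → Prop} {c : ℤ}

/-! ### Systems of holonomies -/

/-- The corners of small rectangles define the holonomy of a small ball. -/
theorem ProductScales.exists_isHolonomyOn_small (h : ProductScales E F c) (p : X) :
    ∃ G, IsHolonomyOn E F p (4 * c) G ∧ ∀ a b, E (4 * c) p a → F (4 * c) p b →
      E (3 * c) b (G a b) ∧ F (3 * c) a (G a b) := by
  have hc := h.fst.nonneg
  have ex : ∀ a b, ∃ w, E (4 * c) p a → F (4 * c) p b → E (3 * c) b w ∧ F (3 * c) a w := by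
    intro a b
    by_cases hab : E (4 * c) p a ∧ F (4 * c) p b
    · obtain ⟨w, h₁, h₂⟩ := h.prod hab.1 hab.2 (by omega)
      exact ⟨w, fun _ _ => ⟨h.fst.mono h₂ (by omega), h.snd.mono h₁ (by omega)⟩⟩
    · exact ⟨a, fun ha hb => absurd ⟨ha, hb⟩ hab⟩
  choose G hG using ex
  have hE₀ : ∀ n, E n p p := fun n => h.fst.refl _ _
  have hF₀ : ∀ n, F n p p := fun n => h.snd.refl _ _
  refine ⟨G, ⟨?_, ?_, ⟨3 * c, fun a b ha hb => hG a b ha hb⟩, ?_, ?_⟩, hG⟩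
  · intro b hb
    exact h.corner_unique (hG p b (hE₀ _) hb).1 (h.fst.refl _ _) (hG p b (hE₀ _) hb).2
      (h.snd.mono hb (by omega)) (by omega)
  · intro a ha
    exact h.corner_unique (hG a p ha (hF₀ _)).1 (h.fst.mono ha (by omega)) (hG a p ha (hF₀ _)).2
      (h.snd.refl _ _) (by omega)
  · refine fun N => ⟨max (4 * c) (N + c), fun a a' b ha ha' hb haa => ?_⟩
    exact h.fst.mono (h.corner_transfer (n' := 2 * c) haa (hG a b ha hb).2 (hG a' b ha' hb).2
      (h.fst.trans' (h.fst.symm (hG a b ha hb).1) (hG a' b ha' hb).1 (by omega) (by omega))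
      (by omega) (by omega)) (by omega)
  · refine fun N => ⟨max (4 * c) (N + c), fun a b b' ha hb hb' hbb => ?_⟩
    exact h.snd.mono (h.swap.corner_transfer (n' := 2 * c) hbb (hG a b ha hb).1 (hG a b' ha hb').1
      (h.snd.trans' (h.snd.symm (hG a b ha hb).2) (hG a b' ha hb').2 (by omega) (by omega))
      (by omega) (by omega)) (by omega)

/-- A pair of transversal scales with fine chains, together with the holonomies `P x` of the leaves
of all points `x`. -/
structure HolonomySystem {X : Type*} (E F : ℤ → X → X → Prop) (c D : ℤ) (P : X → X → X → X) :
    Prop where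
  scales : ProductScales E F c
  fineE : HasFineChains E D
  fineF : HasFineChains F D
  isHolonomy : ∀ x, IsHolonomy E F x (P x)

namespace HolonomySystem

variable {D : ℤ} {P : X → X → X → X}

theorem swap (h : HolonomySystem E F c D P) :
    HolonomySystem F E c D (fun x b a => P x a b) where
  scales := h.scales.swap
  fineE := h.fineF
  fineF := h.fineE
  isHolonomy := fun x => (h.isHolonomy x).swap

/-- Stable equivalence: the classes of `E` are the stable leaves. -/
theorem equivE (h : HolonomySystem E F c D P) : Equivalence fun x y => ∃ n, E n x y where
  refl := fun x => ⟨0, h.scales.fst.refl _ _⟩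
  symm := fun ⟨n, hn⟩ => ⟨n, h.scales.fst.symm hn⟩
  trans := fun ⟨n, hn⟩ ⟨m, hm⟩ => ⟨min n m - c,
    h.scales.fst.trans' hn hm (by omega) (by omega)⟩

theorem equivF (h : HolonomySystem E F c D P) : Equivalence fun x y => ∃ n, F n x y :=
  h.swap.equivE

theorem exists_bound (h : HolonomySystem E F c D P) {x a b : X} (ha : ∃ n, E n x a)
    (hb : ∃ n, F n x b) : ∃ n, E n x a ∧ F n x b := by
  obtain ⟨n, hn⟩ := ha
  obtain ⟨m, hm⟩ := hb
  exact ⟨min n m, h.scales.fst.mono hn (by omega), h.scales.snd.mono hm (by omega)⟩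

theorem memE (h : HolonomySystem E F c D P) {x a b : X} (ha : ∃ n, E n x a)
    (hb : ∃ n, F n x b) : ∃ n, E n b (P x a b) := by
  obtain ⟨n, h₁, h₂⟩ := h.exists_bound ha hb
  obtain ⟨H, hH⟩ := (h.isHolonomy x n).bdd
  exact ⟨H, (hH a b h₁ h₂).1⟩

theorem memF (h : HolonomySystem E F c D P) {x a b : X} (ha : ∃ n, E n x a)
    (hb : ∃ n, F n x b) : ∃ n, F n a (P x a b) := h.swap.memE hb ha

theorem base_left (h : HolonomySystem E F c D P) {x b : X} (hb : ∃ n, F n x b) : P x x b = b :=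
  hb.elim fun _ hb => (h.isHolonomy x).base_left hb

theorem base_right (h : HolonomySystem E F c D P) {x a : X} (ha : ∃ n, E n x a) : P x a x = a :=
  h.swap.base_left ha

theorem base_changeE (h : HolonomySystem E F c D P) {x₀ x a b : X} (hx : ∃ n, E n x₀ x)
    (ha : ∃ n, E n x₀ a) (hb : ∃ n, F n x₀ b) : P x a (P x₀ x b) = P x₀ a b := by
  obtain ⟨n₁, hx⟩ := hx
  obtain ⟨n₂, ha⟩ := ha
  obtain ⟨n₃, hb⟩ := hb
  exact (h.isHolonomy x₀).base_change h.scales h.fineE h.fineF (h.isHolonomy x) hx ha hb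

theorem base_changeF (h : HolonomySystem E F c D P) {x₀ y a b : X} (hy : ∃ n, F n x₀ y)
    (ha : ∃ n, E n x₀ a) (hb : ∃ n, F n x₀ b) : P y (P x₀ a y) b = P x₀ a b :=
  h.swap.base_changeE hy hb ha

/-- The change of the base point from `x₀` to an arbitrary point `P x₀ a b`. -/
theorem base_change (h : HolonomySystem E F c D P) {x₀ a b a' b' : X} (ha : ∃ n, E n x₀ a)
    (hb : ∃ n, F n x₀ b) (ha' : ∃ n, E n x₀ a') (hb' : ∃ n, F n x₀ b') :
    P (P x₀ a b) (P x₀ a' b) (P x₀ a b') = P x₀ a' b' := by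
  rw [← h.base_changeF hb ha hb', h.base_changeE (h.memE ha hb) (h.memE ha' hb)
    (h.equivF.trans (h.equivF.symm hb) hb'), h.base_changeF hb ha' hb']

/-- The holonomy between the stable leaves of `x₀` and of `b` is inverse to the holonomy back. -/
theorem left_inv (h : HolonomySystem E F c D P) {x₀ a b : X} (ha : ∃ n, E n x₀ a)
    (hb : ∃ n, F n x₀ b) : P b (P x₀ a b) x₀ = a := by
  rw [h.base_changeF hb ha (h.equivF.refl _), h.base_right ha]

/-- Small rectangles of the holonomy are the rectangles of the local product structure. -/
theorem eq_corner (h : HolonomySystem E F c D P) {p a b w : X} (ha : E (4 * c + D) p a)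
    (hb : F (4 * c + D) p b) (hw₁ : E (3 * c) b w) (hw₂ : F (3 * c) a w) : P p a b = w := by
  have hc := h.scales.fst.nonneg
  have hD := h.fineE.1
  obtain ⟨G, hG, hG'⟩ := h.scales.exists_isHolonomyOn_small p
  rw [((h.isHolonomy p) (4 * c)).unique h.scales h.fineE h.fineF hG ha hb]
  have := hG' a b (h.scales.fst.mono ha (by omega)) (h.scales.snd.mono hb (by omega))
  exact h.scales.corner_unique this.1 hw₁ this.2 hw₂ (by omega)

/-- The holonomy is a composition of holonomies in rectangles that are images under powers of the
dynamics (by `j`) of rectangles of the small size `N`. -/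
theorem exists_steps (h : HolonomySystem E F c D P) {x₀ x y : X} (hx : ∃ n, E n x₀ x)
    (hy : ∃ n, F n x₀ y) (N : ℤ) :
    Relation.ReflTransGen (fun p q : X × X => ∃ j : ℤ, E (N - j) p.1 q.1 ∧ F (N + j) p.1 p.2 ∧
      E (N - j) p.2 q.2 ∧ F (N + j) q.1 q.2) (x₀, y) (x, P x₀ x y) := by
  obtain ⟨n, hx, hy⟩ := h.exists_bound hx hy
  have hD := h.fineE.1
  obtain ⟨H, hH⟩ := (h.isHolonomy x₀ (n - D)).bdd
  obtain ⟨S, hS⟩ := (h.isHolonomy x₀ (n - D)).cont_left (2 * N - H)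
  have hy' : F (n - D) x₀ y := h.scales.snd.mono hy (by omega)
  have hch := h.fineE.2 _ _ _ hx (max S (2 * N - H))
  have := hch.lift (p := fun p q : X × X => ∃ j : ℤ, E (N - j) p.1 q.1 ∧ F (N + j) p.1 p.2 ∧
      E (N - j) p.2 q.2 ∧ F (N + j) q.1 q.2) (fun a => (a, P x₀ a y)) ?_
  · change Relation.ReflTransGen _ (x₀, P x₀ x₀ y) (x, P x₀ x y) at this
    rwa [h.base_left ⟨_, hy⟩] at this
  · rintro a a' ⟨h₁, h₂, h₃⟩
    -- All unstable sides have log-scale at least `H = N + j`, and the stable sides are fine.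
    refine ⟨H - N, h.scales.fst.mono h₁ (by omega), ?_, ?_, ?_⟩
    · exact h.scales.snd.mono (hH a y h₂ hy').2 (by omega)
    · exact h.scales.fst.mono (hS a a' y h₂ h₃ hy' (h.scales.fst.mono h₁ (by omega))) (by omega)
    · exact h.scales.snd.mono (hH a' y h₃ hy').2 (by omega)

end HolonomySystem
end

noncomputable section

/-! ### The scales of an expansive homeomorphism -/

/-- The relation `ℓ(x, y) ≥ n` of the internal log-scale `ℓ` of the stable leaves of `f`. -/
def scale {X : Type u} [TopologicalSpace X] (f : X ≃ₜ X) (U : Set (X × X)) (n : ℤ) (x y : X) :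
    Prop :=
  ∀ k : ℤ, -n ≤ k → ((f ^ k) x, (f ^ k) y) ∈ U

section Scale

variable {X : Type u} [TopologicalSpace X] {f : X ≃ₜ X} {U : Set (X × X)}

theorem zpow_add_apply (f : X ≃ₜ X) (k l : ℤ) (x : X) : (f ^ (k + l)) x = (f ^ k) ((f ^ l) x) := by
  rw [zpow_add]; rfl

theorem symm_zpow (f : X ≃ₜ X) (k : ℤ) : f.symm ^ k = f ^ (-k) := by
  rw [show f.symm = f⁻¹ from rfl, inv_zpow']

theorem zpow_neg_apply (f : X ≃ₜ X) (k : ℤ) (x : X) : (f ^ k) ((f ^ (-k)) x) = x := by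
  rw [← zpow_add_apply, add_neg_cancel]; rfl

theorem scale_symm_iff {n : ℤ} {x y : X} :
    scale f.symm U n x y ↔ ∀ k : ℤ, k ≤ n → ((f ^ k) x, (f ^ k) y) ∈ U := by
  constructor
  · intro h k hk
    have := h (-k) (by omega)
    rwa [symm_zpow, neg_neg] at this
  · intro h k hk
    rw [symm_zpow]
    exact h _ (by omega)

theorem scale_zpow_iff {n i : ℤ} {x y : X} :
    scale f U n ((f ^ i) x) ((f ^ i) y) ↔ scale f U (n - i) x y := by
  constructor
  · intro h k hk
    have := h (k - i) (by omega)
    rwa [← zpow_add_apply, ← zpow_add_apply, sub_add_cancel] at this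
  · intro h k hk
    rw [← zpow_add_apply, ← zpow_add_apply]
    exact h _ (by omega)

theorem scale_symm_zpow_iff {n i : ℤ} {x y : X} :
    scale f.symm U n ((f ^ i) x) ((f ^ i) y) ↔ scale f.symm U (n + i) x y := by
  have := @scale_zpow_iff X _ f.symm U n (-i) x y
  rwa [symm_zpow, neg_neg, sub_neg_eq_add] at this

theorem scale_mono {n m : ℤ} {x y : X} (h : scale f U n x y) (hm : m ≤ n) : scale f U m x y :=
  fun k hk => h k (by omega)

end Scale

theorem IsLogScale.mono_const {X : Type*} {E : ℤ → X → X → Prop} {c c' : ℤ}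
    (h : IsLogScale E c) (hc : c ≤ c') : IsLogScale E c' where
  nonneg := h.nonneg.trans hc
  refl := h.refl
  symm := h.symm
  mono := h.mono
  trans := fun h₁ h₂ => h.mono (h.trans h₁ h₂) (by omega)

variable {X : Type u} [MetricSpace X] {f : X ≃ₜ X} {U : Set (X × X)}

namespace IsExpansivityNhd

theorem mem_nhds_self (hU : IsExpansivityNhd f U) (x : X) : U ∈ 𝓝 (x, x) :=
  mem_nhdsSet_iff_forall.1 hU.mem_nhds (x, x) rfl

theorem refl (hU : IsExpansivityNhd f U) (x : X) : (x, x) ∈ U :=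
  mem_of_mem_nhds (hU.mem_nhds_self x)

theorem inv (hU : IsExpansivityNhd f U) : IsExpansivityNhd f.symm U where
  isClosed := hU.isClosed
  mem_nhds := hU.mem_nhds
  symm := hU.symm
  expansive := fun x y h => hU.expansive x y fun n => by
    have := h (-n)
    rwa [symm_zpow, neg_neg] at this

theorem eventually_nhds (hU : IsExpansivityNhd f U) (r : ℤ) (x : X) :
    ∀ᶠ p : X × X in 𝓝 (x, x), ∀ k ∈ Icc (-r) r, ((f ^ k) p.1, (f ^ k) p.2) ∈ U := by
  rw [eventually_all_finite (finite_Icc _ _)]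
  intro k _
  have hcont : Continuous fun p : X × X => ((f ^ k) p.1, (f ^ k) p.2) :=
    ((f ^ k).continuous.comp continuous_fst).prodMk ((f ^ k).continuous.comp continuous_snd)
  exact hcont.continuousAt.eventually_mem (hU.mem_nhds_self _)

/-- The orbits of `x` and `y` are close in the future from `-n`, and in the past until `m`. -/
theorem sep (hU : IsExpansivityNhd f U) {n m : ℤ} {x y : X} (h₁ : scale f U n x y)
    (h₂ : scale f.symm U m x y) (hnm : 0 ≤ n + m) : x = y := by
  refine hU.expansive x y fun k => ?_
  rcases le_total (-n) k with hk | hk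
  · exact h₁ k hk
  · exact scale_symm_iff.1 h₂ k (by omega)

variable [CompactSpace X]

theorem eventually_uniformity_iff {p : X × X → Prop} :
    (∀ᶠ z in uniformity X, p z) ↔ ∀ x, ∀ᶠ z in 𝓝 (x, x), p z := by
  rw [← nhdsSet_diagonal_eq_uniformity, eventually_nhdsSet_iff_forall]
  simp [diagonal]

/-- Expansivity is uniform. -/
theorem exists_uniform (hU : IsExpansivityNhd f U) {ε : ℝ} (hε : 0 < ε) :
    ∃ N : ℕ, ∀ x y, (∀ k ∈ Icc (-(N : ℤ)) N, ((f ^ k) x, (f ^ k) y) ∈ U) → dist x y < ε := by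
  by_contra! hcon
  set t : ℕ → Set (X × X) := fun N =>
    {p | (∀ k ∈ Icc (-(N : ℤ)) N, ((f ^ k) p.1, (f ^ k) p.2) ∈ U) ∧ ε ≤ dist p.1 p.2} with ht
  have hclosed : ∀ N, IsClosed (t N) := by
    intro N
    have hset : {p : X × X | ∀ k ∈ Icc (-(N : ℤ)) N, ((f ^ k) p.1, (f ^ k) p.2) ∈ U} =
        ⋂ k ∈ Icc (-(N : ℤ)) N, (fun p : X × X => ((f ^ k) p.1, (f ^ k) p.2)) ⁻¹' U := by
      ext p; simp
    have hcl : IsClosed {p : X × X | ∀ k ∈ Icc (-(N : ℤ)) N, ((f ^ k) p.1, (f ^ k) p.2) ∈ U} := by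
      rw [hset]
      refine isClosed_biInter fun k _ => hU.isClosed.preimage ?_
      exact ((f ^ k).continuous.comp continuous_fst).prodMk
        ((f ^ k).continuous.comp continuous_snd)
    exact hcl.inter (isClosed_le continuous_const continuous_dist)
  obtain ⟨⟨x, y⟩, hxy⟩ := IsCompact.nonempty_iInter_of_sequence_nonempty_isCompact_isClosed t
    (fun N p hp => ⟨fun k hk => hp.1 k ⟨by have := hk.1; push_cast; omega,
      by have := hk.2; push_cast; omega⟩, hp.2⟩)
    (fun N => by obtain ⟨x, y, h₁, h₂⟩ := hcon N; exact ⟨(x, y), h₁, h₂⟩)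
    (hclosed 0).isCompact hclosed
  rw [mem_iInter] at hxy
  have : x = y := hU.expansive x y fun k =>
    (hxy k.natAbs).1 k ⟨by omega, by omega⟩
  have h2 := (hxy 0).2
  simp only [this, dist_self] at h2
  linarith

theorem dist_lt_of_scale (hU : IsExpansivityNhd f U) {ε : ℝ} (hε : 0 < ε) :
    ∃ N : ℕ, ∀ (n : ℤ) (x y : X), scale f U n x y → ∀ k : ℤ, -n + N ≤ k →
      dist ((f ^ k) x) ((f ^ k) y) < ε := by
  obtain ⟨N, hN⟩ := hU.exists_uniform hε
  refine ⟨N, fun n x y h k hk => hN _ _ fun j hj => ?_⟩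
  rw [← zpow_add_apply, ← zpow_add_apply]
  exact h _ (by have := hj.1; omega)

theorem exists_dist_lt (hU : IsExpansivityNhd f U) : ∃ ε > 0, ∀ x y, dist x y < ε → (x, y) ∈ U := by
  have : U ∈ uniformity X := by rw [← nhdsSet_diagonal_eq_uniformity]; exact hU.mem_nhds
  obtain ⟨ε, hε, h⟩ := Metric.mem_uniformity_dist.1 this
  exact ⟨ε, hε, fun x y hxy => h hxy⟩

theorem exists_isLogScale (hU : IsExpansivityNhd f U) : ∃ c, IsLogScale (scale f U) c := by
  obtain ⟨ε, hε, h⟩ := hU.exists_dist_lt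
  obtain ⟨N, hN⟩ := hU.dist_lt_of_scale (half_pos hε)
  refine ⟨N, by positivity, fun n x k _ => hU.refl _, fun h k hk => hU.symm _ _ (h k hk),
    scale_mono, fun {n x y z} h₁ h₂ k hk => h _ _ ?_⟩
  linarith [dist_triangle ((f ^ k) x) ((f ^ k) y) ((f ^ k) z), hN n x y h₁ k (by omega),
    hN n y z h₂ k (by omega)]

/-- Local product structure at the uniform small scale gives the product structure at all scales:
shifting by the powers of `f` gives candidates `w j` for the fourth corner, and all of them
coincide by expansivity. -/
theorem exists_productScales (hU : IsExpansivityNhd f U)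
    (hL : ∀ r : ℤ, ∀ᶠ p in uniformity X, ∃ w, scale f U r p.2 w ∧ scale f.symm U r p.1 w) :
    ∃ c, ProductScales (scale f U) (scale f.symm U) c := by
  obtain ⟨c₁, hc₁⟩ := hU.exists_isLogScale
  obtain ⟨c₂, hc₂⟩ := hU.inv.exists_isLogScale
  obtain ⟨c, hc, hcc₁, hcc₂⟩ : ∃ c, 0 ≤ c ∧ c₁ ≤ c ∧ c₂ ≤ c :=
    ⟨max 0 (max c₁ c₂), by omega, by omega, by omega⟩
  have hE := hc₁.mono_const hcc₁
  have hF := hc₂.mono_const hcc₂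
  obtain ⟨δ, hδ, hLδ⟩ := Metric.mem_uniformity_dist.1 (hL (c + 1))
  obtain ⟨N₁, hN₁⟩ := hU.dist_lt_of_scale (half_pos hδ)
  obtain ⟨N₂, hN₂⟩ := hU.inv.dist_lt_of_scale (half_pos hδ)
  obtain ⟨N, hN, hNN₁, hNN₂⟩ : ∃ N : ℤ, c ≤ N ∧ N₁ ≤ N ∧ N₂ ≤ N :=
    ⟨max c (max N₁ N₂), by omega, by omega, by omega⟩
  have base : ∀ x y z, scale f U N x y → scale f.symm U N x z →
      ∃ w, scale f U (c + 1) z w ∧ scale f.symm U (c + 1) y w := by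
    intro x y z hxy hxz
    have h₁ := hN₁ N x y hxy 0 (by omega)
    have h₂ := hN₂ N x z hxz 0 (by omega)
    refine hLδ (a := y) (b := z) ?_
    simp only [zpow_zero] at h₁ h₂
    change dist x y < _ at h₁
    change dist x z < _ at h₂
    linarith [dist_triangle_left y z x]
  refine ⟨2 * N, hE.mono_const (by omega), hF.mono_const (by omega), hU.sep, ?_⟩
  intro n m x y z hxy hxz hnm
  -- For `N - n ≤ j ≤ m - N`, the points `f ^ j x`, `f ^ j y`, `f ^ j z` are close to each other.
  have step : ∀ j : ℤ, ∃ w, N - n ≤ j → j ≤ m - N →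
      scale f U (c + 1 - j) z w ∧ scale f.symm U (c + 1 + j) y w := by
    intro j
    by_cases hj : N - n ≤ j ∧ j ≤ m - N
    · obtain ⟨w, hw₁, hw₂⟩ := base ((f ^ j) x) ((f ^ j) y) ((f ^ j) z)
        (scale_zpow_iff.2 (scale_mono hxy (by omega)))
        (scale_symm_zpow_iff.2 (scale_mono hxz (by omega)))
      refine ⟨(f ^ (-j)) w, fun _ _ => ?_⟩
      rw [← zpow_neg_apply f j w] at hw₁ hw₂
      exact ⟨scale_zpow_iff.1 hw₁, scale_symm_zpow_iff.1 hw₂⟩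
    · exact ⟨x, fun h₁ h₂ => absurd ⟨h₁, h₂⟩ hj⟩
  choose w hw using step
  have hconst : ∀ i : ℕ, N - n + i ≤ m - N → w (N - n + i) = w (N - n) := by
    intro i
    induction i with
    | zero => intro _; simp
    | succ i ih =>
      intro hi
      push_cast at hi
      rw [← ih (by omega)]
      obtain ⟨a₁, a₂⟩ := hw (N - n + i) (by omega) (by omega)
      obtain ⟨b₁, b₂⟩ := hw (N - n + (i + 1 : ℕ)) (by omega) (by push_cast; omega)
      refine hU.sep (n := c + 1 - (N - n + (i + 1 : ℕ)) - c) (m := c + 1 + (N - n + i) - c)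
        (hE.trans (hE.symm b₁) (hE.mono a₁ ?_)) (hF.trans (hF.symm (hF.mono b₂ ?_)) a₂) ?_ <;>
        push_cast <;> omega
  obtain ⟨i, hi⟩ : ∃ i : ℕ, m - N = N - n + i := ⟨(m - N - (N - n)).toNat, by omega⟩
  obtain ⟨a₁, a₂⟩ := hw (N - n) le_rfl (by omega)
  obtain ⟨b₁, b₂⟩ := hw (N - n + i) (by omega) (by omega)
  rw [hconst i (by omega)] at b₁ b₂
  exact ⟨w (N - n), hF.mono b₂ (by omega), hE.mono a₁ (by omega)⟩

end IsExpansivityNhd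
end

noncomputable section

/-! ### Rectangles of a Smale space -/

namespace Rectangle

variable {X : Type u} [TopologicalSpace X]

theorem br_mem_plaque₁ (R : Rectangle X) {y z : X} (hy : y ∈ R.carrier) (hz : z ∈ R.carrier) :
    R.br y z ∈ R.plaque₁ z :=
  ⟨R.br_mem y hy z hz, by rw [R.br_br_right z hz y hy z hz, R.br_self z hz]⟩

theorem br_mem_plaque₂ (R : Rectangle X) {y z : X} (hy : y ∈ R.carrier) (hz : z ∈ R.carrier) :
    R.br y z ∈ R.plaque₂ y :=
  ⟨R.br_mem y hy z hz, R.br_br_right y hy y hy z hz⟩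

theorem br_eq_of_mem_plaque₁ (R : Rectangle X) {x y : X} (hx : x ∈ R.carrier)
    (hy : y ∈ R.plaque₁ x) : R.br y x = y := by
  have := R.br_br_right y hy.1 x hx y hy.1
  rwa [hy.2, R.br_self y hy.1] at this

/-- The image of a rectangle under a homeomorphism. -/
def map (g : X ≃ₜ X) (R : Rectangle X) : Rectangle X where
  carrier := g.symm ⁻¹' R.carrier
  isOpen_carrier := R.isOpen_carrier.preimage g.symm.continuous
  br y z := g (R.br (g.symm y) (g.symm z))
  br_mem := fun y hy z hz => by
    rw [mem_preimage, g.symm_apply_apply]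
    exact R.br_mem _ hy _ hz
  continuousOn_br := by
    refine g.continuous.comp_continuousOn (R.continuousOn_br.comp (f := fun p : X × X =>
      (g.symm p.1, g.symm p.2)) ?_ fun p hp => ⟨hp.1, hp.2⟩)
    exact (Continuous.prodMk (g.symm.continuous.comp continuous_fst)
      (g.symm.continuous.comp continuous_snd)).continuousOn
  br_self := fun x hx => by rw [R.br_self _ hx, g.apply_symm_apply]
  br_br_left := fun x hx y hy z hz => by
    rw [g.symm_apply_apply, R.br_br_left _ hx _ hy _ hz]
  br_br_right := fun x hx y hy z hz => by
    rw [g.symm_apply_apply, R.br_br_right _ hx _ hy _ hz]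

/-- The rectangular hull `[V, V]` of an open subset `V` of a rectangle. -/
def hull (R : Rectangle X) (V : Set X) (hV : IsOpen V) (hVR : V ⊆ R.carrier) : Rectangle X where
  carrier := (fun p : X × X => R.br p.1 p.2) '' V ×ˢ V
  isOpen_carrier := by
    rw [isOpen_iff_mem_nhds]
    rintro _ ⟨⟨y, z⟩, ⟨hy, hz⟩, rfl⟩
    -- A point `w` close to `[y, z]` is equal to `[[w, y], [z, w]]`.
    have hyR := hVR hy
    have hzR := hVR hz
    have hw := R.br_mem y hyR z hzR
    have hR := R.isOpen_carrier.mem_nhds hw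
    have c₁ : Tendsto (fun w => R.br w y) (𝓝 (R.br y z)) (𝓝 y) := by
      have h := (R.continuousOn_br.continuousAt (x := (R.br y z, y))
        (prod_mem_nhds hR (R.isOpen_carrier.mem_nhds hyR)))
      have h' := h.comp (f := fun w => (w, y)) (x := R.br y z) (by fun_prop)
      simpa [ContinuousAt, R.br_br_left y hyR z hzR y hyR, R.br_self y hyR, Function.comp_def]
        using h'
    have c₂ : Tendsto (fun w => R.br z w) (𝓝 (R.br y z)) (𝓝 z) := by
      have h := (R.continuousOn_br.continuousAt (x := (z, R.br y z))
        (prod_mem_nhds (R.isOpen_carrier.mem_nhds hzR) hR))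
      have h' := h.comp (f := fun w => (z, w)) (x := R.br y z) (by fun_prop)
      simpa [ContinuousAt, R.br_br_right z hzR y hyR z hzR, R.br_self z hzR, Function.comp_def]
        using h'
    filter_upwards [hR, c₁ (hV.mem_nhds hy), c₂ (hV.mem_nhds hz)] with w hwR h₁ h₂
    refine ⟨(R.br w y, R.br z w), ⟨h₁, h₂⟩, ?_⟩
    change R.br (R.br w y) (R.br z w) = w
    rw [R.br_br_left w hwR y hyR _ (hVR h₂), R.br_br_right w hwR z hzR w hwR, R.br_self w hwR]
  br := R.br
  br_mem := by
    rintro _ ⟨⟨x, y⟩, ⟨hx, hy⟩, rfl⟩ _ ⟨⟨z, w⟩, ⟨hz, hw⟩, rfl⟩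
    refine ⟨(x, w), ⟨hx, hw⟩, ?_⟩
    change R.br x w = R.br (R.br x y) (R.br z w)
    rw [R.br_br_left x (hVR hx) y (hVR hy) _ (R.br_mem z (hVR hz) w (hVR hw)),
      R.br_br_right x (hVR hx) z (hVR hz) w (hVR hw)]
  continuousOn_br := R.continuousOn_br.mono <| by
    have : (fun p : X × X => R.br p.1 p.2) '' V ×ˢ V ⊆ R.carrier := by
      rintro _ ⟨p, hp, rfl⟩
      exact R.br_mem _ (hVR hp.1) _ (hVR hp.2)
    exact prod_mono this this
  br_self := by
    rintro _ ⟨p, hp, rfl⟩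
    exact R.br_self _ (R.br_mem _ (hVR hp.1) _ (hVR hp.2))
  br_br_left := by
    rintro _ ⟨p, hp, rfl⟩ _ ⟨q, hq, rfl⟩ _ ⟨r, hr, rfl⟩
    exact R.br_br_left _ (R.br_mem _ (hVR hp.1) _ (hVR hp.2)) _
      (R.br_mem _ (hVR hq.1) _ (hVR hq.2)) _ (R.br_mem _ (hVR hr.1) _ (hVR hr.2))
  br_br_right := by
    rintro _ ⟨p, hp, rfl⟩ _ ⟨q, hq, rfl⟩ _ ⟨r, hr, rfl⟩
    exact R.br_br_right _ (R.br_mem _ (hVR hp.1) _ (hVR hp.2)) _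
      (R.br_mem _ (hVR hq.1) _ (hVR hq.2)) _ (R.br_mem _ (hVR hr.1) _ (hVR hr.2))

/-- The bracket is continuous at the points of the diagonal. -/
theorem tendsto_br (R : Rectangle X) {x : X} (hx : x ∈ R.carrier) :
    Tendsto (fun p : X × X => R.br p.1 p.2) (𝓝 (x, x)) (𝓝 x) := by
  have := R.continuousOn_br.continuousAt (x := (x, x))
    (prod_mem_nhds (R.isOpen_carrier.mem_nhds hx) (R.isOpen_carrier.mem_nhds hx))
  rwa [ContinuousAt, R.br_self x hx] at this

end Rectangle

theorem eventually_prod_iff_exists_nhds {X : Type*} [TopologicalSpace X] {x : X}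
    {p : X × X → Prop} :
    (∀ᶠ z in 𝓝 (x, x), p z) ↔ ∃ N ∈ 𝓝 x, ∀ y ∈ N, ∀ z ∈ N, p (y, z) := by
  constructor
  · intro h
    obtain ⟨N, hN, N', hN', h'⟩ := mem_nhds_prod_iff.1 h
    exact ⟨N ∩ N', inter_mem hN hN', fun y hy z hz => h' ⟨hy.1, hz.2⟩⟩
  · rintro ⟨N, hN, h⟩
    filter_upwards [prod_mem_nhds hN hN] with z hz
    exact h z.1 hz.1 z.2 hz.2

theorem LocalProductStructure.IsSubrectangle.compatible {X : Type u} [TopologicalSpace X]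
    {L : LocalProductStructure X} {R S : Rectangle X} (hR : L.IsSubrectangle R)
    (hS : L.IsSubrectangle S) : R.Compatible S := by
  intro x
  obtain ⟨T, hT, hxT⟩ := L.cover x
  obtain ⟨N₁, hN₁, h₁⟩ := hR T hT x
  obtain ⟨N₂, hN₂, h₂⟩ := hS T hT x
  refine ⟨N₁ ∩ N₂ ∩ T.carrier, inter_mem (inter_mem hN₁ hN₂) (T.isOpen_carrier.mem_nhds hxT), ?_⟩
  rintro y ⟨⟨⟨⟨y₁, y₂⟩, y₃⟩, y₄⟩, y₅⟩ z ⟨⟨⟨⟨z₁, z₂⟩, z₃⟩, z₄⟩, z₅⟩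
  rw [h₁ y ⟨⟨y₁, y₄⟩, y₃⟩ z ⟨⟨z₁, z₄⟩, z₃⟩, h₂ y ⟨⟨y₂, y₅⟩, y₃⟩ z ⟨⟨z₂, z₅⟩, z₃⟩]

theorem LocalProductStructure.isSubrectangle_of_mem {X : Type u} [TopologicalSpace X]
    (L : LocalProductStructure X) {R : Rectangle X} (hR : R ∈ L.rects) : L.IsSubrectangle R :=
  fun S hS => L.compat R hR S hS

variable {X : Type u} [MetricSpace X] [CompactSpace X] {f : X ≃ₜ X} {U : Set (X × X)}
  {L : LocalProductStructure X}

/-- For points in a small set that are forward asymptotic with a uniform speed, the log-scale is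
big. -/
theorem IsExpansivityNhd.eventually_scale (hU : IsExpansivityNhd f U) {C r : ℝ} (hC : 0 < C)
    (hr₀ : 0 < r) (hr₁ : r < 1) (x : X) (N : ℤ) :
    ∀ᶠ p : X × X in 𝓝 (x, x),
      (∀ n : ℕ, dist ((f ^ n) p.1) ((f ^ n) p.2) ≤ C * r ^ n * dist p.1 p.2) →
        scale f U N p.1 p.2 := by
  obtain ⟨ε, hε, hεU⟩ := hU.exists_dist_lt
  have hdist : ∀ᶠ p : X × X in 𝓝 (x, x), dist p.1 p.2 < ε / C := by
    have : Tendsto (fun p : X × X => dist p.1 p.2) (𝓝 (x, x)) (𝓝 (dist x x)) :=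
      continuous_dist.continuousAt
    rw [dist_self] at this
    exact this.eventually_lt_const (by positivity)
  filter_upwards [hdist, hU.eventually_nhds |N| x] with p hp₁ hp₂ h k hk
  by_cases hkN : k ≤ |N|
  · exact hp₂ k ⟨by have := le_abs_self N; omega, hkN⟩
  · have := abs_nonneg N
    obtain ⟨n, rfl⟩ := Int.eq_ofNat_of_zero_le (by omega : 0 ≤ k)
    refine hεU _ _ ?_
    rw [zpow_natCast]
    have h1 : r ^ n ≤ 1 := pow_le_one₀ hr₀.le hr₁.le
    have h2 : dist p.1 p.2 * C < ε := by rwa [lt_div_iff₀ hC] at hp₁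
    have h3 : C * r ^ n * dist p.1 p.2 ≤ C * 1 * dist p.1 p.2 := by gcongr
    linarith [h n]

/-- Close to every point the bracket `[y, z]` is stably close to `z` and unstably close to `y`. -/
theorem IsSmaleSpace.eventually_br (hf : IsSmaleSpace f L) (hU : IsExpansivityNhd f U)
    {R : Rectangle X} (hR : L.IsSubrectangle R) (x : X) (N : ℤ) :
    ∀ᶠ p : X × X in 𝓝 (x, x), p.1 ∈ R.carrier → p.2 ∈ R.carrier →
      scale f U N p.2 (R.br p.1 p.2) ∧ scale f.symm U N p.1 (R.br p.1 p.2) := by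
  obtain ⟨-, C, hC, r, hr₀, hr₁, h⟩ := hf
  obtain ⟨S, hS, hxS, h⟩ := h x
  obtain ⟨W, hW, hWRS⟩ := hR.compatible hS x
  have t₁ : Tendsto (fun p : X × X => (p.2, S.br p.1 p.2)) (𝓝 (x, x)) (𝓝 (x, x)) :=
    (continuous_snd.tendsto' (x, x) x rfl).prodMk_nhds (S.tendsto_br hxS)
  have t₂ : Tendsto (fun p : X × X => (p.1, S.br p.1 p.2)) (𝓝 (x, x)) (𝓝 (x, x)) :=
    (continuous_fst.tendsto' (x, x) x rfl).prodMk_nhds (S.tendsto_br hxS)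
  have hSn := S.isOpen_carrier.mem_nhds hxS
  filter_upwards [prod_mem_nhds hW hW, prod_mem_nhds hSn hSn,
    t₁.eventually (hU.eventually_scale hC hr₀ hr₁ x N),
    t₂.eventually (hU.inv.eventually_scale hC hr₀ hr₁ x N)] with p hpW hpS h₁ h₂ hp₁ hp₂
  rw [hWRS p.1 ⟨⟨hpW.1, hp₁⟩, hpS.1⟩ p.2 ⟨⟨hpW.2, hp₂⟩, hpS.2⟩]
  refine ⟨h₁ ?_, h₂ ?_⟩
  · exact (h p.2 hpS.2).1 p.2 ⟨hpS.2, S.br_self _ hpS.2⟩ _ (S.br_mem_plaque₁ hpS.1 hpS.2)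
  · exact (h p.1 hpS.1).2 p.1 ⟨hpS.1, S.br_self _ hpS.1⟩ _ (S.br_mem_plaque₂ hpS.1 hpS.2)

/-- Close points have a common point of small local stable and unstable leaves. -/
theorem IsSmaleSpace.eventually_exists (hf : IsSmaleSpace f L) (hU : IsExpansivityNhd f U)
    (N : ℤ) : ∀ᶠ p in uniformity X, ∃ w, scale f U N p.2 w ∧ scale f.symm U N p.1 w := by
  rw [IsExpansivityNhd.eventually_uniformity_iff]
  intro x
  obtain ⟨S, hS, hxS⟩ := L.cover x
  have hSn := S.isOpen_carrier.mem_nhds hxS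
  filter_upwards [prod_mem_nhds hSn hSn,
    hf.eventually_br hU (L.isSubrectangle_of_mem hS) x N] with p hp h
  exact ⟨_, h hp.1 hp.2⟩

variable {c : ℤ}

/-- A rectangle belongs to the local product structure if its brackets are, locally, the
intersections of local stable and unstable leaves. -/
theorem IsSmaleSpace.isSubrectangle (hf : IsSmaleSpace f L) (hU : IsExpansivityNhd f U)
    (hEF : ProductScales (scale f U) (scale f.symm U) c) {R : Rectangle X}
    (hR : ∀ x, ∀ᶠ p : X × X in 𝓝 (x, x), p.1 ∈ R.carrier → p.2 ∈ R.carrier →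
      scale f U c p.2 (R.br p.1 p.2) ∧ scale f.symm U c p.1 (R.br p.1 p.2)) :
    L.IsSubrectangle R := by
  intro S hS x
  have := (hR x).and (hf.eventually_br hU (L.isSubrectangle_of_mem hS) x c)
  obtain ⟨N, hN, h⟩ := eventually_prod_iff_exists_nhds.1 this
  refine ⟨N, hN, fun y hy z hz => ?_⟩
  obtain ⟨h₁, h₂⟩ := h y hy.1.1 z hz.1.1
  replace h₁ := h₁ hy.1.2 hz.1.2
  replace h₂ := h₂ hy.2 hz.2
  exact hEF.corner_unique h₁.1 h₂.1 h₁.2 h₂.2 (by omega)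

/-- The images of rectangles under powers of `f` are rectangles. -/
theorem IsSmaleSpace.isSubrectangle_map (hf : IsSmaleSpace f L) (hU : IsExpansivityNhd f U)
    (hEF : ProductScales (scale f U) (scale f.symm U) c) {R : Rectangle X}
    (hR : L.IsSubrectangle R) (i : ℤ) : L.IsSubrectangle (R.map (f ^ i)) := by
  refine hf.isSubrectangle hU hEF fun x => ?_
  have hcont : Tendsto (fun p : X × X => ((f ^ i).symm p.1, (f ^ i).symm p.2)) (𝓝 (x, x))
      (𝓝 ((f ^ i).symm x, (f ^ i).symm x)) :=
    (Continuous.prodMk ((f ^ i).symm.continuous.comp continuous_fst)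
      ((f ^ i).symm.continuous.comp continuous_snd)).continuousAt
  filter_upwards [hcont.eventually (hf.eventually_br hU hR _ (c + |i|))] with p hp h₁ h₂
  have hi₁ := le_abs_self i
  have hi₂ := neg_abs_le i
  obtain ⟨h₃, h₄⟩ := hp h₁ h₂
  constructor
  · rw [← (f ^ i).apply_symm_apply p.2]
    change scale f U c _ ((f ^ i) (R.br ((f ^ i).symm p.1) ((f ^ i).symm ((f ^ i) _))))
    rw [(f ^ i).symm_apply_apply]
    exact scale_zpow_iff.2 (scale_mono h₃ (by omega))
  · rw [← (f ^ i).apply_symm_apply p.1]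
    change scale f.symm U c _ ((f ^ i) (R.br ((f ^ i).symm ((f ^ i) _)) ((f ^ i).symm p.2)))
    rw [(f ^ i).symm_apply_apply]
    exact scale_symm_zpow_iff.2 (scale_mono h₄ (by omega))

/-- Every point has a small connected rectangular neighbourhood. -/
theorem IsSmaleSpace.exists_small_rectangle [LocallyConnectedSpace X] (hf : IsSmaleSpace f L)
    (hU : IsExpansivityNhd f U) (x : X) (N : ℤ) :
    ∃ R : Rectangle X, L.IsSubrectangle R ∧ IsConnected R.carrier ∧ x ∈ R.carrier ∧
      ∀ y ∈ R.carrier, ∀ z ∈ R.carrier,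
        scale f U N z (R.br y z) ∧ scale f.symm U N y (R.br y z) := by
  obtain ⟨S, hS, hxS⟩ := L.cover x
  have hSn := S.isOpen_carrier.mem_nhds hxS
  have hsub := L.isSubrectangle_of_mem hS
  obtain ⟨W, hW, h⟩ := eventually_prod_iff_exists_nhds.1 (hf.eventually_br hU hsub x N)
  obtain ⟨V', hV', h'⟩ := eventually_prod_iff_exists_nhds.1
    ((S.tendsto_br hxS).eventually (inter_mem hW hSn))
  obtain ⟨V, hVV', hVo, hxV, hVc⟩ := locallyConnectedSpace_iff_subsets_isOpen_isConnected.1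
    inferInstance x (V' ∩ S.carrier) (inter_mem hV' hSn)
  have hVS : V ⊆ S.carrier := fun y hy => (hVV' hy).2
  have hull_sub : (S.hull V hVo hVS).carrier ⊆ W ∩ S.carrier := by
    rintro _ ⟨p, hp, rfl⟩
    exact h' p.1 (hVV' hp.1).1 p.2 (hVV' hp.2).1
  refine ⟨S.hull V hVo hVS, ?_, ?_, ⟨(x, x), ⟨hxV, hxV⟩, S.br_self x hxS⟩, ?_⟩
  · intro T hT y
    obtain ⟨M, hM, hMT⟩ := hsub T hT y
    exact ⟨M, hM, fun z hz w hw => hMT z ⟨⟨hz.1.1, (hull_sub hz.1.2).2⟩, hz.2⟩ w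
      ⟨⟨hw.1.1, (hull_sub hw.1.2).2⟩, hw.2⟩⟩
  · exact (hVc.prod hVc).image _ (S.continuousOn_br.mono (prod_mono hVS hVS))
  · intro y hy z hz
    exact h y (hull_sub hy).1 z (hull_sub hz).1 (hull_sub hy).2 (hull_sub hz).2
end

noncomputable section

/-! ### Leaves, exponents and the pinching condition -/

variable {X : Type u} [MetricSpace X] {f : X ≃ₜ X} {U : Set (X × X)}

theorem coe_le_logScale_iff {n : ℝ} {x y : X} :
    (n : EReal) ≤ logScale f U x y ↔ scale f U ⌈n⌉ x y := by
  constructor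
  · intro h
    by_contra hn
    have : logScale f U x y ≤ ((⌈n⌉ - 1 : ℝ) : EReal) := by
      refine sSup_le ?_
      rintro _ ⟨m, rfl, hm⟩
      have hlt : m < ⌈n⌉ := by
        by_contra! hle
        exact hn (scale_mono hm hle)
      have : (m : ℝ) ≤ ⌈n⌉ - 1 := by exact_mod_cast Int.le_sub_one_of_lt hlt
      exact_mod_cast this
    have h2 : n ≤ ⌈n⌉ - 1 := by exact_mod_cast h.trans this
    linarith [Int.ceil_lt_add_one n]
  · intro h
    refine le_trans ?_ (le_sSup ⟨⌈n⌉, rfl, h⟩)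
    exact_mod_cast Int.le_ceil n

theorem intCast_le_logScale_iff {n : ℤ} {x y : X} :
    ((n : ℝ) : EReal) ≤ logScale f U x y ↔ scale f U n x y := by
  rw [coe_le_logScale_iff, Int.ceil_intCast]

theorem exists_logScale_eq (hU : IsExpansivityNhd f U) {x y : X} (hxy : x ≠ y) {n : ℤ}
    (hn : scale f U n x y) : ∃ l : ℤ, logScale f U x y = ((l : ℝ) : EReal) ∧ n ≤ l := by
  have hbdd : ∃ b : ℤ, ∀ m : ℤ, scale f U m x y → m ≤ b := by
    by_contra! hcon
    refine hxy (hU.expansive x y fun k => ?_)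
    obtain ⟨m, hm, hmk⟩ := hcon (-k)
    exact hm k (by omega)
  obtain ⟨l, hl, hmax⟩ := Int.exists_greatest_of_bdd hbdd ⟨n, hn⟩
  refine ⟨l, le_antisymm (sSup_le ?_) (intCast_le_logScale_iff.2 hl), hmax n hn⟩
  rintro _ ⟨m, rfl, hm⟩
  exact_mod_cast hmax m hm

theorem StepChain.head {X : Type*} {r : X → X → Prop} {k : ℕ} {x y z : X} (hxy : r x y)
    (h : StepChain r k y z) : StepChain r (k + 1) x z := by
  induction k generalizing z with
  | zero => cases h; exact ⟨x, rfl, hxy⟩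
  | succ k ih =>
    obtain ⟨w, hw, hwz⟩ := h
    exact ⟨w, ih hw, hwz⟩

section Compact

variable [CompactSpace X]

theorem mem_stableLeaf_iff (hU : IsExpansivityNhd f U) {x y : X} :
    y ∈ stableLeaf f x ↔ ∃ n, scale f U n x y := by
  constructor
  · intro h
    obtain ⟨ε, hε, hεU⟩ := hU.exists_dist_lt
    obtain ⟨n, hn⟩ := eventually_atTop.1 (h.eventually_lt_const hε)
    refine ⟨-n, fun k hk => hεU _ _ ?_⟩
    obtain ⟨m, rfl⟩ := Int.eq_ofNat_of_zero_le (by omega : 0 ≤ k)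
    exact hn m (by omega)
  · rintro ⟨n, hn⟩
    refine Metric.tendsto_atTop.2 fun ε hε => ?_
    obtain ⟨N, hN⟩ := hU.dist_lt_of_scale hε
    refine ⟨(-n + N).toNat, fun m hm => ?_⟩
    rw [Real.dist_0_eq_abs, abs_of_nonneg dist_nonneg]
    exact hN n x y hn m (by omega)

theorem stepChain_of_walk (hU : IsExpansivityNhd f U) {x₀ : X} {n : ℤ} {y z : stableLeaf f x₀}
    (w : (leafGraph f U x₀ n).Walk y z) : StepChain (scale f U n) w.length y.1 z.1 := by
  obtain ⟨c, hc⟩ := hU.exists_isLogScale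
  induction w with
  | nil => rfl
  | cons h p ih =>
    refine StepChain.head ?_ ih
    rcases h.2 with h | h
    · exact intCast_le_logScale_iff.1 h
    · exact hc.symm (intCast_le_logScale_iff.1 h)

theorem edist_le_of_stepChain (hU : IsExpansivityNhd f U) {n : ℤ} {k : ℕ} {x y : X}
    (h : StepChain (scale f U n) k x y) (hx : x ∈ stableLeaf f x) :
    ∃ hy : y ∈ stableLeaf f x, (leafGraph f U x n).edist ⟨x, hx⟩ ⟨y, hy⟩ ≤ k := by
  obtain ⟨c, hc⟩ := hU.exists_isLogScale
  induction k generalizing y with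
  | zero => cases h; exact ⟨hx, by simp⟩
  | succ k ih =>
    obtain ⟨w, hw, hwy⟩ := h
    obtain ⟨hwL, hd⟩ := ih hw
    have hyL : y ∈ stableLeaf f x := by
      obtain ⟨m, hm⟩ := (mem_stableLeaf_iff hU).1 hwL
      exact (mem_stableLeaf_iff hU).2
        ⟨min n m - c, hc.trans' hm hwy (by omega) (by omega)⟩
    refine ⟨hyL, (SimpleGraph.edist_triangle (v := ⟨w, hwL⟩)).trans ?_⟩
    push_cast
    refine add_le_add hd ?_
    by_cases hwy' : w = y
    · subst hwy'; simp
    · refine le_of_eq (SimpleGraph.edist_eq_one_iff_adj.2 ?_)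
      exact ⟨fun h => hwy' (congrArg Subtype.val h), Or.inl (intCast_le_logScale_iff.2 hwy)⟩

theorem IsUpperExponent.upperExp (hU : IsExpansivityNhd f U) {α : ℝ}
    (h : IsUpperExponent f U α) : ∃ A > 0, UpperExp (scale f U) α A := by
  obtain ⟨hα, C, hC, h⟩ := h
  refine ⟨max C 1, by positivity, fun m n x y hmn hxy => ?_⟩
  have hmn' : (m : ℝ) ≤ n := by exact_mod_cast hmn
  by_cases hne : x = y
  · exact ⟨0, by simp only [CharP.cast_eq_zero]; positivity, hne⟩
  obtain ⟨l, hl, hml⟩ := exists_logScale_eq hU hne hxy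
  have hml' : (m : ℝ) ≤ l := by exact_mod_cast hml
  by_cases hnl : n ≤ l
  · refine ⟨1, ?_, x, rfl, intCast_le_logScale_iff.1 (by rw [hl]; exact_mod_cast hnl)⟩
    have h1 : 1 ≤ Real.exp (α * (n - m)) := Real.one_le_exp (by nlinarith)
    push_cast
    nlinarith [le_max_right C 1]
  have hxL : x ∈ stableLeaf f x := (mem_stableLeaf_iff hU).2 ⟨0, fun k _ => hU.refl _⟩
  have hyL : y ∈ stableLeaf f x := (mem_stableLeaf_iff hU).2 ⟨m, hxy⟩
  have hd := h x ⟨x, hxL⟩ ⟨y, hyL⟩ (fun h => hne (congrArg Subtype.val h)) n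
    (by rw [hl]; exact_mod_cast (not_le.1 hnl).le)
  rw [hl, EReal.toReal_coe] at hd
  have hreach : (leafGraph f U x n).edist ⟨x, hxL⟩ ⟨y, hyL⟩ ≠ ⊤ := by
    intro htop
    rw [htop, ENat.toENNReal_top] at hd
    exact absurd hd (by simp)
  obtain ⟨w, hw⟩ := (SimpleGraph.reachable_of_edist_ne_top hreach).exists_walk_length_eq_edist
  refine ⟨w.length, ?_, stepChain_of_walk hU w⟩
  rw [← hw, ENat.toENNReal_coe, ← ENNReal.ofReal_natCast,
    ENNReal.ofReal_le_ofReal_iff (by positivity)] at hd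
  refine hd.trans ?_
  gcongr
  exact le_max_left _ _

theorem IsLowerExponent.lowerExp (hU : IsExpansivityNhd f U) {α : ℝ}
    (h : IsLowerExponent f U α) : ∃ A > 0, LowerExp (scale f U) α A := by
  obtain ⟨hα, C, hC, h⟩ := h
  refine ⟨C, hC, fun n m k x y hxy hk => ?_⟩
  by_cases hne : x = y
  · subst hne; exact fun k _ => hU.refl _
  by_contra hm
  have hxL : x ∈ stableLeaf f x := (mem_stableLeaf_iff hU).2 ⟨0, fun k _ => hU.refl _⟩
  obtain ⟨hyL, hd⟩ := edist_le_of_stepChain hU hxy hxL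
  obtain ⟨j, hj⟩ := (mem_stableLeaf_iff hU).1 hyL
  obtain ⟨l, hl, -⟩ := exists_logScale_eq hU hne hj
  have hlm : l ≤ m := by
    by_contra! hlm
    exact hm (intCast_le_logScale_iff.1 (by rw [hl]; exact_mod_cast hlm.le))
  have h1 := h x ⟨x, hxL⟩ ⟨y, hyL⟩ (fun h => hne (congrArg Subtype.val h)) n
  rw [hl, EReal.toReal_coe] at h1
  have h2 := h1.trans (ENat.toENNReal_le.2 hd)
  rw [ENat.toENNReal_coe, ← ENNReal.ofReal_natCast, ENNReal.ofReal_le_ofReal_iff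
    (by positivity)] at h2
  have hlm' : (l : ℝ) ≤ m := by exact_mod_cast hlm
  have h3 : C * Real.exp (α * (n - m)) ≤ C * Real.exp (α * (n - l)) := by gcongr
  linarith

/-- If some leaf is not a point, then lower exponents do not exceed upper exponents. -/
theorem lowerCriticalExponent_le_upper (hU : IsExpansivityNhd f U) {x y : X} (hxy : x ≠ y) {j : ℤ}
    (hj : scale f U j x y) : lowerCriticalExponent f U ≤ upperCriticalExponent f U := by
  refine iSup₂_le fun α₀ h₀ => le_iInf₂ fun α₁ h₁ => ENNReal.ofReal_le_ofReal ?_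
  by_contra! hlt
  obtain ⟨-, C₀, hC₀, h₀⟩ := h₀
  obtain ⟨-, C₁, hC₁, h₁⟩ := h₁
  obtain ⟨l, hl, -⟩ := exists_logScale_eq hU hxy hj
  have hxL : x ∈ stableLeaf f x := (mem_stableLeaf_iff hU).2 ⟨0, fun k _ => hU.refl _⟩
  have hyL : y ∈ stableLeaf f x := (mem_stableLeaf_iff hU).2 ⟨j, hj⟩
  have hne : (⟨x, hxL⟩ : stableLeaf f x) ≠ ⟨y, hyL⟩ := fun h => hxy (congrArg Subtype.val h)
  have hd : 0 < α₀ - α₁ := by linarith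
  -- For `t` with `C₀ ((α₀ - α₁) t + 1) > C₁`, the exponential bounds at `n = l + t` contradict.
  set t := C₁ / C₀ / (α₀ - α₁) with ht
  have ht₀ : 0 ≤ t := by positivity
  have h2 := (h₀ x _ _ hne (l + t)).trans (h₁ x _ _ hne (l + t)
    (by rw [hl]; exact_mod_cast (by linarith : (l : ℝ) ≤ l + t)))
  rw [hl, EReal.toReal_coe, ENNReal.ofReal_le_ofReal_iff (by positivity), add_sub_cancel_left] at h2
  have h3 : α₀ * t = (α₀ - α₁) * t + α₁ * t := by ring
  rw [h3, Real.exp_add, ← mul_assoc] at h2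
  have h4 := le_of_mul_le_mul_right h2 (Real.exp_pos _)
  have h5 := Real.add_one_le_exp ((α₀ - α₁) * t)
  rw [ht, mul_div_cancel₀ _ hd.ne'] at h5
  rw [ht, mul_div_cancel₀ _ hd.ne'] at h4
  have h6 : C₀ * (C₁ / C₀ + 1) ≤ C₁ := le_trans (by gcongr) h4
  rw [mul_add, mul_div_cancel₀ _ hC₀.ne'] at h6
  linarith

/-- If every point has a neighbourhood inside its stable leaf, then `X` is a point: `X` is one leaf
of finite diameter, and powers of `f` shrink it. -/
theorem subsingleton_of_open_leaves [ConnectedSpace X] (hU : IsExpansivityNhd f U)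
    (h : ∀ᶠ p in uniformity X, scale f U 0 p.1 p.2) : Subsingleton X := by
  obtain ⟨c, hc⟩ := hU.exists_isLogScale
  have hc₀ := hc.nonneg
  have hloc : ∀ x, ∀ᶠ y in 𝓝 x, scale f U 0 x y := fun x => by
    rw [nhds_eq_comap_uniformity]
    exact eventually_comap.2 (h.mono fun p hp y hy => by subst hy; exact hp)
  have hleaf : ∀ x y, ∃ n, scale f U n x y := by
    intro x y
    have : Std.Symm fun x y => ∃ n, scale f U n x y := ⟨fun _ _ h => h.imp fun _ => hc.symm⟩
    refine PreconnectedSpace.induction₂ (fun x y => ∃ n, scale f U n x y)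
      (fun x => (hloc x).mono fun y hy => ⟨0, hy⟩) ⟨?_⟩ x y
    rintro a b d ⟨n, hn⟩ ⟨m, hm⟩
    exact ⟨min n m - c, hc.trans' hn hm (by omega) (by omega)⟩
  obtain ⟨x₀⟩ := (inferInstance : Nonempty X)
  choose l hl using hleaf x₀
  obtain ⟨t, ht⟩ := CompactSpace.elim_nhds_subcover (fun x => {y | scale f U 0 x y}) hloc
  obtain ⟨N, hN⟩ : ∃ N : ℤ, ∀ y ∈ t, N ≤ l y := by
    obtain ⟨N, hN⟩ := (t.image fun y => -l y).exists_le
    exact ⟨-N, fun y hy => by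
      have := hN _ (Finset.mem_image_of_mem (fun y => -l y) hy)
      omega⟩
  have h₁ : ∀ y, scale f U (min N 0 - c) x₀ y := by
    intro y
    have hy : y ∈ ⋃ x ∈ t, {y | scale f U 0 x y} := by rw [ht]; trivial
    simp only [mem_iUnion] at hy
    obtain ⟨x, hx, hxy⟩ := hy
    have := hN x hx
    exact hc.trans' (hl x) hxy (by omega) (by omega)
  have h₂ : ∀ x y, scale f U (min N 0 - c - c) x y := fun x y => hc.trans (hc.symm (h₁ x)) (h₁ y)
  refine ⟨fun x y => hU.expansive x y fun k => ?_⟩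
  have := scale_zpow_iff.1 (h₂ ((f ^ (min N 0 - c - c + k)) x) ((f ^ (min N 0 - c - c + k)) y))
  exact this k (by omega)

end Compact

theorem isLowerExponent_of_subsingleton [Subsingleton X] {α : ℝ} (hα : 0 < α) :
    IsLowerExponent f U α :=
  ⟨hα, 1, one_pos, fun _ _ _ hne => absurd (Subsingleton.elim _ _) hne⟩

theorem isUpperExponent_of_subsingleton [Subsingleton X] {α : ℝ} (hα : 0 < α) :
    IsUpperExponent f U α :=
  ⟨hα, 1, one_pos, fun _ _ _ hne => absurd (Subsingleton.elim _ _) hne⟩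

theorem exists_isLowerExponent_of_lt {a : ℝ}
    (h : ENNReal.ofReal a < lowerCriticalExponent f U) : ∃ α, a < α ∧ IsLowerExponent f U α := by
  simp only [lowerCriticalExponent, lt_iSup_iff] at h
  obtain ⟨α, hα, h⟩ := h
  exact ⟨α, (ENNReal.ofReal_lt_ofReal_iff hα.1).1 h, hα⟩

theorem exists_isUpperExponent_of_lt {a : ℝ} (ha : 0 < a)
    (h : upperCriticalExponent f U < ENNReal.ofReal a) : ∃ α, α < a ∧ IsUpperExponent f U α := by
  simp only [upperCriticalExponent, iInf_lt_iff] at h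
  obtain ⟨α, hα, h⟩ := h
  exact ⟨α, (ENNReal.ofReal_lt_ofReal_iff ha).1 h, hα⟩

/-- An approximation of the quotient of the critical exponents by quotients of exponents. -/
theorem exists_exponents_of_lt (hle : lowerCriticalExponent f U ≤ upperCriticalExponent f U)
    (hpos : lowerCriticalExponent f U / upperCriticalExponent f U ≠ 0) {q : ℝ}
    (hq : ENNReal.ofReal q < lowerCriticalExponent f U / upperCriticalExponent f U) :
    ∃ α₀ α₁, IsLowerExponent f U α₀ ∧ IsUpperExponent f U α₁ ∧ q < α₀ / α₁ := by
  set a := lowerCriticalExponent f U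
  set b := upperCriticalExponent f U
  have ha : a ≠ 0 := fun h => hpos (by rw [h, ENNReal.zero_div])
  have hb : b ≠ ⊤ := fun h => hpos (by rw [h, ENNReal.div_top])
  have ha' : a ≠ ⊤ := ne_top_of_le_ne_top hb hle
  have hb' : b ≠ 0 := fun h => ha (le_antisymm (h ▸ hle) bot_le)
  have ha₀ : 0 < a.toReal := ENNReal.toReal_pos ha ha'
  have hb₀ : 0 < b.toReal := ENNReal.toReal_pos hb' hb
  rw [← ENNReal.ofReal_toReal ha', ← ENNReal.ofReal_toReal hb, ← ENNReal.ofReal_div_of_pos hb₀,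
    ENNReal.ofReal_lt_ofReal_iff (by positivity)] at hq
  have hcont : ContinuousAt (fun t : ℝ => (a.toReal - t) / (b.toReal + t)) 0 :=
    ContinuousAt.div (by fun_prop) (by fun_prop) (by simpa using hb₀.ne')
  have hev : ∀ᶠ t in 𝓝[>] (0 : ℝ), q < (a.toReal - t) / (b.toReal + t) ∧ t < a.toReal := by
    refine nhdsWithin_le_nhds ?_
    refine (hcont.eventually (lt_mem_nhds (by simpa using hq))).and (gt_mem_nhds ha₀)
  obtain ⟨t, ⟨h₁, h₂⟩, ht⟩ := (hev.and self_mem_nhdsWithin).exists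
  replace ht : 0 < t := ht
  obtain ⟨α₀, h₀, hα₀⟩ := exists_isLowerExponent_of_lt (f := f) (U := U) (a := a.toReal - t)
    ((ENNReal.ofReal_lt_iff_lt_toReal (by linarith) ha').2 (by linarith))
  obtain ⟨α₁, h₃, hα₁⟩ := exists_isUpperExponent_of_lt (f := f) (U := U) (a := b.toReal + t)
    (by linarith) ((ENNReal.lt_ofReal_iff_toReal_lt hb).2 (by linarith))
  refine ⟨α₀, α₁, hα₀, hα₁, h₁.trans_le ?_⟩
  have := hα₁.1
  have := hα₀.1
  gcongr

/-- The pinching condition for actual exponents.  If the leaves of one kind are points, then `X`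
is a point, and all positive numbers are exponents.  Otherwise the quotients of the critical
exponents are at most one, so the condition implies that they are positive, and hence that the
critical exponents are positive and finite. -/
theorem PinchedSpectrum.exists_exponents [CompactSpace X] [ConnectedSpace X]
    (hU : IsExpansivityNhd f U)
    (hL : ∀ᶠ p in uniformity X, ∃ w, scale f U 0 p.2 w ∧ scale f.symm U 0 p.1 w)
    (hp : PinchedSpectrum f U) : ∃ α₀ α₁ β₀ β₁, IsLowerExponent f U α₀ ∧
      IsUpperExponent f U α₁ ∧ IsLowerExponent f.symm U β₀ ∧ IsUpperExponent f.symm U β₁ ∧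
      1 < α₀ / α₁ + β₀ / β₁ := by
  by_cases hsub : Subsingleton X
  · exact ⟨1, 1, 1, 1, isLowerExponent_of_subsingleton one_pos,
      isUpperExponent_of_subsingleton one_pos, isLowerExponent_of_subsingleton one_pos,
      isUpperExponent_of_subsingleton one_pos, by norm_num⟩
  -- If the leaves of one kind are points, then the leaves of the other kind are open.
  have h₁ : ∃ x y, x ≠ y ∧ ∃ n, scale f U n x y := by
    by_contra! hcon
    refine hsub (subsingleton_of_open_leaves hU.inv ?_)
    filter_upwards [hL] with p ⟨w, hw₁, hw₂⟩
    by_cases hpw : p.2 = w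
    · rwa [hpw]
    · exact absurd hw₁ (hcon _ _ hpw _)
  have h₂ : ∃ x y, x ≠ y ∧ ∃ n, scale f.symm U n x y := by
    by_contra! hcon
    refine hsub (subsingleton_of_open_leaves hU ?_)
    filter_upwards [hL] with p ⟨w, hw₁, hw₂⟩
    by_cases hpw : p.1 = w
    · rw [hpw]
      exact fun k hk => hU.symm _ _ (hw₁ k hk)
    · exact absurd hw₂ (hcon _ _ hpw _)
  obtain ⟨x, y, hxy, n, hn⟩ := h₁
  obtain ⟨x', y', hxy', n', hn'⟩ := h₂
  have hle := lowerCriticalExponent_le_upper hU hxy hn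
  have hle' := lowerCriticalExponent_le_upper hU.inv hxy' hn'
  unfold PinchedSpectrum at hp
  set A := lowerCriticalExponent f U / upperCriticalExponent f U with hA
  set B := lowerCriticalExponent f.symm U / upperCriticalExponent f.symm U with hB
  have hA₁ : A ≤ 1 := ENNReal.div_le_of_le_mul (by rwa [one_mul])
  have hB₁ : B ≤ 1 := ENNReal.div_le_of_le_mul (by rwa [one_mul])
  have hA₀ : A ≠ 0 := fun h => by
    rw [h, zero_add] at hp
    exact absurd hp (not_lt.2 hB₁)
  have hB₀ : B ≠ 0 := fun h => by
    rw [h, add_zero] at hp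
    exact absurd hp (not_lt.2 hA₁)
  have hAt := ne_top_of_le_ne_top ENNReal.one_ne_top hA₁
  have hBt := ne_top_of_le_ne_top ENNReal.one_ne_top hB₁
  have hAr : 0 < A.toReal := ENNReal.toReal_pos hA₀ hAt
  have hBr : 0 < B.toReal := ENNReal.toReal_pos hB₀ hBt
  have hsum : 1 < A.toReal + B.toReal := by
    rw [← ENNReal.toReal_add hAt hBt, ← ENNReal.toReal_one]
    exact (ENNReal.toReal_lt_toReal ENNReal.one_ne_top (ENNReal.add_ne_top.2 ⟨hAt, hBt⟩)).2 hp
  obtain ⟨s, hs, hsA, hsB⟩ : ∃ s, 0 < s ∧ s < A.toReal ∧ s < B.toReal ∧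
      1 < (A.toReal - s) + (B.toReal - s) := by
    obtain ⟨s, hs₀, hs₁⟩ := exists_between (show (0 : ℝ) <
      min (min A.toReal B.toReal) ((A.toReal + B.toReal - 1) / 2) by
        simp only [lt_min_iff]
        exact ⟨⟨hAr, hBr⟩, by linarith⟩)
    simp only [lt_min_iff] at hs₁
    exact ⟨s, hs₀, hs₁.1.1, hs₁.1.2, by linarith [hs₁.2]⟩
  obtain ⟨α₀, α₁, h₁, h₂, h₃⟩ := exists_exponents_of_lt hle hA₀ (q := A.toReal - s)
    ((ENNReal.ofReal_lt_iff_lt_toReal (by linarith) hAt).2 (by linarith))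
  obtain ⟨β₀, β₁, h₄, h₅, h₆⟩ := exists_exponents_of_lt hle' hB₀ (q := B.toReal - s)
    ((ENNReal.ofReal_lt_iff_lt_toReal (by linarith) hBt).2 (by linarith))
  exact ⟨α₀, α₁, β₀, β₁, h₁, h₂, h₄, h₅, by linarith⟩
end

noncomputable section

/-! ### The internal topology of leaves -/

variable {X : Type u} [MetricSpace X] {f : X ≃ₜ X} {U : Set (X × X)}

namespace Leaf

variable {x₀ : X}

theorem val_injective : Function.Injective (Leaf.val : Leaf f U x₀ → X) := Subtype.val_injective

theorem isOpen_iff {O : Set (Leaf f U x₀)} : IsOpen O ↔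
    ∀ y ∈ O, ∃ n : ℤ, ∀ z : Leaf f U x₀, scale f U n y.val z.val → z ∈ O := by
  constructor
  · intro h y hy
    obtain ⟨n, hn⟩ := h y hy
    exact ⟨⌈n⌉, fun z hz => hn z (coe_le_logScale_iff.2 hz)⟩
  · intro h y hy
    obtain ⟨n, hn⟩ := h y hy
    exact ⟨n, fun z hz => hn z (intCast_le_logScale_iff.1 hz)⟩

variable [CompactSpace X]

theorem exists_scale (hU : IsExpansivityNhd f U) (y : Leaf f U x₀) : ∃ n, scale f U n x₀ y.val :=
  (mem_stableLeaf_iff hU).1 y.2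

/-- The point of a leaf given by a point of `X` that is stably equivalent to `x₀`. -/
def mk (hU : IsExpansivityNhd f U) (y : X) (hy : ∃ n, scale f U n x₀ y) : Leaf f U x₀ :=
  ⟨y, (mem_stableLeaf_iff hU).2 hy⟩

theorem mem_nhds_iff (hU : IsExpansivityNhd f U) {y : Leaf f U x₀} {s : Set (Leaf f U x₀)} :
    s ∈ 𝓝 y ↔ ∃ n : ℤ, ∀ z : Leaf f U x₀, scale f U n y.val z.val → z ∈ s := by
  obtain ⟨c, hc⟩ := hU.exists_isLogScale
  have hc₀ := hc.nonneg
  constructor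
  · intro h
    obtain ⟨O, hOs, hO, hy⟩ := _root_.mem_nhds_iff.1 h
    obtain ⟨n, hn⟩ := isOpen_iff.1 hO y hy
    exact ⟨n, fun z hz => hOs (hn z hz)⟩
  · rintro ⟨n, hn⟩
    refine _root_.mem_nhds_iff.2 ⟨{z | ∃ k : ℤ, ∀ w : Leaf f U x₀, scale f U k z.val w.val → w ∈ s},
      fun z ⟨k, hk⟩ => hk z (hc.refl _ _), isOpen_iff.2 ?_, n, hn⟩
    rintro z ⟨k, hk⟩
    exact ⟨k + c, fun w hw => ⟨k + c, fun v hv => hk v (hc.trans' hw hv le_rfl le_rfl)⟩⟩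

theorem eventually_scale (hU : IsExpansivityNhd f U) (y : Leaf f U x₀) (n : ℤ) :
    ∀ᶠ z in 𝓝 y, scale f U n y.val z.val :=
  (mem_nhds_iff hU).2 ⟨n, fun _ hz => hz⟩

theorem continuous_iff (hU : IsExpansivityNhd f U) {T : Type*} [TopologicalSpace T]
    {g : T → Leaf f U x₀} :
    Continuous g ↔ ∀ (t : T) (n : ℤ), ∀ᶠ s in 𝓝 t, scale f U n (g t).val (g s).val := by
  rw [continuous_iff_continuousAt]
  constructor
  · exact fun h t n => (h t).eventually (eventually_scale hU (g t) n)
  · intro h t s hs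
    obtain ⟨n, hn⟩ := (mem_nhds_iff hU).1 hs
    exact (h t n).mono fun z hz => hn _ hz

end Leaf

namespace HolonomySystem

variable {F : ℤ → X → X → Prop} {c D : ℤ} {P : X → X → X → X}

/-- The holonomy between stable leaves along an unstable one is continuous for the internal
topologies. -/
theorem exists_scale_holonomy (h : HolonomySystem (scale f U) F c D P) {x₀ a b : X}
    (ha : ∃ n, scale f U n x₀ a) (hb : ∃ n, F n x₀ b) (N : ℤ) :
    ∃ S, ∀ a', scale f U S a a' → scale f U N (P x₀ a b) (P x₀ a' b) := by
  obtain ⟨n, ha, hb⟩ := h.exists_bound ha hb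
  have hc := h.scales.fst.nonneg
  obtain ⟨S, hS⟩ := (h.isHolonomy x₀ (n - c)).cont_left N
  refine ⟨max S n, fun a' ha' => hS a a' b (scale_mono ha (by omega)) ?_
    (h.scales.snd.mono hb (by omega)) (scale_mono ha' (by omega))⟩
  exact h.scales.fst.trans' ha ha' (by omega) (by omega)

variable [CompactSpace X]

/-- The holonomy from the stable leaf of `x₀` to the stable leaf of `P x₀ a b`, as a homeomorphism
for the internal topologies. -/
def leafHomeomorph (h : HolonomySystem (scale f U) F c D P) (hU : IsExpansivityNhd f U)
    {x₀ a b : X} (ha : ∃ n, scale f U n x₀ a) (hb : ∃ n, F n x₀ b) :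
    Leaf f U x₀ ≃ₜ Leaf f U (P x₀ a b) where
  toFun y := Leaf.mk hU (P x₀ y.val b) (h.equivE.trans (h.equivE.symm (h.memE ha hb))
    (h.memE (y.exists_scale hU) hb))
  invFun w := Leaf.mk hU (P b w.val x₀) (h.memE (h.equivE.trans (h.memE ha hb) (w.exists_scale hU))
    (h.equivF.symm hb))
  left_inv y := Leaf.val_injective (h.left_inv (y.exists_scale hU) hb)
  right_inv w := Leaf.val_injective
    (h.left_inv (h.equivE.trans (h.memE ha hb) (w.exists_scale hU)) (h.equivF.symm hb))
  continuous_toFun := (Leaf.continuous_iff hU).2 fun y n => by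
    obtain ⟨S, hS⟩ := h.exists_scale_holonomy (y.exists_scale hU) hb n
    exact (Leaf.eventually_scale hU y S).mono fun z hz => hS _ hz
  continuous_invFun := (Leaf.continuous_iff hU).2 fun y n => by
    obtain ⟨S, hS⟩ := h.exists_scale_holonomy
      (h.equivE.trans (h.memE ha hb) (y.exists_scale hU)) (h.equivF.symm hb) n
    exact (Leaf.eventually_scale hU y S).mono fun z hz => hS _ hz

end HolonomySystem

/-! ### Evenly covered sets from a relation of lying on the same sheet -/

/-- Let `r` be an equivalence relation on `π ⁻¹' S` such that `π` maps every class (sheet)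
bijectively onto `S`, the classes are open, and the inverses `S → π ⁻¹' S` of `π` on the sheets are
continuous.  Then the points of `S` are evenly covered. -/
theorem isEvenlyCovered_of_sheets {M : Type*} {X : Type*} [TopologicalSpace M] [TopologicalSpace X]
    {π : M → X} (hπ : Continuous π) {S : Set X} (hS : IsOpen S) {r : M → M → Prop}
    (symm : ∀ m m', r m m' → r m' m) (trans : ∀ m m' m'', r m m' → r m' m'' → r m m'')
    (exist : ∀ m, π m ∈ S → ∀ q ∈ S, ∃ m', r m m' ∧ π m' = q)
    (unique : ∀ m m', r m m' → π m = π m' → m = m')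
    (isOpen : ∀ m, π m ∈ S → ∀ᶠ m' in 𝓝 m, r m m')
    (cont : ∀ m, π m ∈ S → ∀ V ∈ 𝓝 m, ∀ᶠ q in 𝓝 (π m), ∀ m', r m m' → π m' = q → m' ∈ V)
    {x : X} (hx : x ∈ S) : IsEvenlyCovered π x (π ⁻¹' {x}) := by
  choose σ hσ using fun (m : M) (hm : π m ∈ S) (q : S) => exist m hm q q.2
  have hσeq : ∀ m hm m', r m m' → ∀ hm' : π m' ∈ S, σ m hm ⟨π m', hm'⟩ = m' :=
    fun m hm m' hmm hm' =>
    unique _ _ (trans _ _ _ (symm _ _ (hσ m hm ⟨π m', hm'⟩).1) hmm) (hσ m hm ⟨π m', hm'⟩).2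
  have hrefl : ∀ m, π m ∈ S → r m m := fun m hm => by
    obtain ⟨m', h₁, -⟩ := exist m hm x hx
    exact trans _ _ _ h₁ (symm _ _ h₁)
  have hfib : ∀ i : π ⁻¹' {x}, π i.1 ∈ S := fun i => by
    have : π i.1 = x := i.2
    rwa [this]
  have hconst : ∀ m m' hm hm', r m m' → σ m hm ⟨x, hx⟩ = σ m' hm' ⟨x, hx⟩ :=
    fun m m' hm hm' hmm => unique _ _ (trans _ _ _ (symm _ _ (hσ m hm ⟨x, hx⟩).1)
      (trans _ _ _ hmm (hσ m' hm' ⟨x, hx⟩).1)) ((hσ _ _ _).2.trans (hσ _ _ _).2.symm)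
  have hdisc : DiscreteTopology (π ⁻¹' {x}) := by
    refine discreteTopology_iff_isOpen_singleton.2 fun i => isOpen_iff_mem_nhds.2 ?_
    rintro j (rfl : j = i)
    filter_upwards [continuous_subtype_val.continuousAt.eventually (isOpen j.1 (hfib j))]
      with i' hi'
    have e : π i'.1 = π j.1 := (show π i'.1 = x from i'.2).trans (show π j.1 = x from j.2).symm
    exact Subtype.ext (unique _ _ (symm _ _ hi') e)
  refine ⟨hdisc, S, hx, hS, hS.preimage hπ, ?_⟩
  refine ⟨{
    toFun := fun m => (⟨π m.1, m.2⟩, ⟨σ m.1 m.2 ⟨x, hx⟩, (hσ m.1 m.2 ⟨x, hx⟩).2⟩)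
    invFun := fun p => ⟨σ p.2.1 (hfib p.2) p.1, by
      rw [mem_preimage, (hσ p.2.1 (hfib p.2) p.1).2]; exact p.1.2⟩
    left_inv := ?_
    right_inv := ?_
    continuous_toFun := ?_
    continuous_invFun := ?_ }, fun m => rfl⟩
  · rintro ⟨m, hm⟩
    refine Subtype.ext (hσeq _ _ _ ?_ hm)
    exact symm _ _ (hσ m hm ⟨x, hx⟩).1
  · rintro ⟨q, i⟩
    refine Prod.ext (Subtype.ext (hσ _ _ _).2) (Subtype.ext ?_)
    refine unique _ _ ?_ ((hσ _ _ _).2.trans i.2.symm)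
    exact trans _ _ _ (symm _ _ (hσ _ _ _).1) (symm _ _ (hσ i.1 (hfib i) q).1)
  · refine (Continuous.subtype_mk (hπ.comp continuous_subtype_val) _).prodMk ?_
    refine IsLocallyConstant.continuous ?_
    rw [IsLocallyConstant.iff_eventually_eq]
    rintro ⟨m, hm⟩
    have := (continuous_subtype_val (p := (· ∈ π ⁻¹' S))).continuousAt (x := ⟨m, hm⟩)
    filter_upwards [this.eventually (isOpen m hm)] with m' hm'
    exact Subtype.ext (hconst _ _ _ _ (symm _ _ hm'))
  · refine Continuous.subtype_mk (continuous_iff_continuousAt.2 ?_) _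
    rintro ⟨q, i⟩ V hV
    have hq : π (σ i.1 (hfib i) q) = q := (hσ i.1 (hfib i) q).2
    have hev := cont _ (by rw [hq]; exact q.2) V hV
    rw [hq] at hev
    have h₁ : ∀ᶠ p : S × (π ⁻¹' {x}) in 𝓝 (q, i), p.2 = i :=
      (continuous_snd.tendsto' (q, i) i rfl).eventually
        ((isOpen_discrete {i}).mem_nhds rfl)
    have h₂ := ((continuous_subtype_val.comp continuous_fst).tendsto'
      ((q, i) : S × (π ⁻¹' {x})) q.1 rfl).eventually hev
    refine mem_map.2 ?_
    filter_upwards [h₁, h₂] with p hp₁ hp₂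
    obtain ⟨q', i'⟩ := p
    subst hp₁
    exact hp₂ _ (trans _ _ _ (symm _ _ (hσ _ _ q).1) (hσ _ _ q').1) (hσ _ _ q').2
end

noncomputable section

/-! ### The holonomy map is a splitting -/

namespace HolonomySystem

variable {X : Type u} [MetricSpace X] {f : X ≃ₜ X} {U : Set (X × X)}
  {L : LocalProductStructure X} {c D : ℤ} {P : X → X → X → X} {x₀ : X}

/-- The map `W₊(x₀) × W₋(x₀) → X` given by the holonomy. -/
def proj (P : X → X → X → X) (m : Leaf f U x₀ × Leaf f.symm U x₀) : X := P x₀ m.1.val m.2.val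

/-- A rectangle in which the bracket `[y, z]` has log-scales at least `N` to `z` and to `y`. -/
def IsSmall (f : X ≃ₜ X) (U : Set (X × X)) (N : ℤ) (R : Rectangle X) : Prop :=
  ∀ y ∈ R.carrier, ∀ z ∈ R.carrier, scale f U N z (R.br y z) ∧ scale f.symm U N y (R.br y z)

/-- The points `m`, `m'` lie on one sheet over the rectangle `R`: the two other corners of the
rectangle with the opposite corners `m`, `m'` are mapped to the brackets of the images. -/
def SameSheet (P : X → X → X → X) (R : Rectangle X) (m m' : Leaf f U x₀ × Leaf f.symm U x₀) :
    Prop :=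
  proj P m ∈ R.carrier ∧ proj P m' ∈ R.carrier ∧
    proj P (m'.1, m.2) = R.br (proj P m') (proj P m) ∧
    proj P (m.1, m'.2) = R.br (proj P m) (proj P m')

/-- In a small rectangle, the bracket is the holonomy. -/
theorem eq_br (h : HolonomySystem (scale f U) (scale f.symm U) c D P)
    {R : Rectangle X} (hR : IsSmall f U (4 * c + D) R) {p q q' : X}
    (hp : p ∈ R.carrier) (hq : q ∈ R.carrier) (hq' : q' ∈ R.carrier) :
    P p (R.br q p) (R.br p q') = R.br q q' := by
  have hc := h.scales.fst.nonneg
  have hD := h.fineE.1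
  refine h.eq_corner (hR q hq p hp).1 (hR p hp q' hq').2 ?_ ?_
  · exact h.scales.fst.trans' (h.scales.fst.symm (hR p hp q' hq').1) (hR q hq q' hq').1
      (by omega) (by omega)
  · exact h.scales.snd.trans' (h.scales.snd.symm (hR q hq p hp).2) (hR q hq q' hq').2
      (by omega) (by omega)

theorem scale_corner (h : HolonomySystem (scale f U) (scale f.symm U) c D P)
    {N : ℤ} (hN : 4 * c + D ≤ N) {p a b : X} (ha : scale f U N p a)
    (hb : scale f.symm U N p b) :
    scale f U (N - c) b (P p a b) ∧ scale f.symm U (N - c) a (P p a b) := by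
  have hc := h.scales.fst.nonneg
  have hD := h.fineE.1
  obtain ⟨w, hw₁, hw₂⟩ := h.scales.prod ha hb (by omega)
  rw [h.eq_corner (scale_mono ha hN) (scale_mono hb hN) (scale_mono hw₂ (by omega))
    (scale_mono hw₁ (by omega))]
  exact ⟨hw₂, hw₁⟩

theorem SameSheet.symm {R : Rectangle X} {m m' : Leaf f U x₀ × Leaf f.symm U x₀}
    (hm : SameSheet P R m m') : SameSheet P R m' m := ⟨hm.2.1, hm.1, hm.2.2.2, hm.2.2.1⟩

variable [CompactSpace X]

theorem proj_base_change (h : HolonomySystem (scale f U) (scale f.symm U) c D P)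
    (hU : IsExpansivityNhd f U) (m m' : Leaf f U x₀ × Leaf f.symm U x₀) :
    P (proj P m) (proj P (m'.1, m.2)) (proj P (m.1, m'.2)) = proj P m' :=
  h.base_change (m.1.exists_scale hU) (m.2.exists_scale hU.inv) (m'.1.exists_scale hU)
    (m'.2.exists_scale hU.inv)

theorem proj_left_inv (h : HolonomySystem (scale f U) (scale f.symm U) c D P)
    (hU : IsExpansivityNhd f U) (m : Leaf f U x₀ × Leaf f.symm U x₀) :
    P m.2.val (proj P m) x₀ = m.1.val :=
  h.left_inv (m.1.exists_scale hU) (m.2.exists_scale hU.inv)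

theorem proj_right_inv (h : HolonomySystem (scale f U) (scale f.symm U) c D P)
    (hU : IsExpansivityNhd f U) (m : Leaf f U x₀ × Leaf f.symm U x₀) :
    P m.1.val x₀ (proj P m) = m.2.val :=
  h.swap.left_inv (m.2.exists_scale hU.inv) (m.1.exists_scale hU)

theorem sameSheet_trans (h : HolonomySystem (scale f U) (scale f.symm U) c D P)
    (hU : IsExpansivityNhd f U) {R : Rectangle X} (hR : IsSmall f U (4 * c + D) R)
    {m m' m'' : Leaf f U x₀ × Leaf f.symm U x₀} (h₁ : SameSheet P R m m')
    (h₂ : SameSheet P R m' m'') : SameSheet P R m m'' := by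
  refine ⟨h₁.1, h₂.2.1, ?_, ?_⟩
  · rw [← h.proj_base_change hU m' (m''.1, m.2), h₂.2.2.1, h₁.2.2.1,
      h.eq_br hR h₂.1 h₂.2.1 h₁.1]
  · rw [← h.proj_base_change hU m' (m.1, m''.2), h₂.2.2.2, h₁.2.2.2,
      h.eq_br hR h₂.1 h₁.1 h₂.2.1]

/-- The projection is injective on a sheet. -/
theorem sameSheet_unique (h : HolonomySystem (scale f U) (scale f.symm U) c D P)
    (hU : IsExpansivityNhd f U) {R : Rectangle X} {m m' : Leaf f U x₀ × Leaf f.symm U x₀}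
    (hm : SameSheet P R m m') (he : proj P m = proj P m') : m = m' := by
  obtain ⟨h₁, -, h₂, h₃⟩ := hm
  rw [← he, R.br_self _ h₁] at h₂ h₃
  refine Prod.ext (Leaf.val_injective ?_) (Leaf.val_injective ?_)
  · rw [← h.proj_left_inv hU m, ← h.proj_left_inv hU (m'.1, m.2), h₂]
  · rw [← h.proj_right_inv hU m, ← h.proj_right_inv hU (m.1, m'.2), h₃]

/-- A sheet over `R` covers `R`. -/
theorem exists_sameSheet (h : HolonomySystem (scale f U) (scale f.symm U) c D P)
    (hU : IsExpansivityNhd f U) {R : Rectangle X} (hR : IsSmall f U (4 * c + D) R)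
    {m : Leaf f U x₀ × Leaf f.symm U x₀} (hm : proj P m ∈ R.carrier) {q : X}
    (hq : q ∈ R.carrier) : ∃ m', SameSheet P R m m' ∧ proj P m' = q := by
  have ha := m.1.exists_scale hU
  have hb := m.2.exists_scale hU.inv
  have h₁ : ∃ n, scale f U n m.2.val (R.br q (proj P m)) :=
    h.equivE.trans (h.memE ha hb) ⟨_, (hR q hq _ hm).1⟩
  have h₂ : ∃ n, scale f.symm U n m.1.val (R.br (proj P m) q) :=
    h.equivF.trans (h.memF ha hb) ⟨_, (hR _ hm q hq).2⟩
  set m' : Leaf f U x₀ × Leaf f.symm U x₀ :=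
    (Leaf.mk hU (P m.2.val (R.br q (proj P m)) x₀) (h.memE h₁ (h.equivF.symm hb)),
      Leaf.mk hU.inv (P m.1.val x₀ (R.br (proj P m) q)) (h.memF (h.equivE.symm ha) h₂)) with hm'
  have e₁ : proj P (m'.1, m.2) = R.br q (proj P m) := h.left_inv h₁ (h.equivF.symm hb)
  have e₂ : proj P (m.1, m'.2) = R.br (proj P m) q := h.swap.left_inv h₂ (h.equivE.symm ha)
  have e : proj P m' = q := by
    rw [← h.proj_base_change hU m m', e₁, e₂, h.eq_br hR hm hq hq, R.br_self q hq]
  exact ⟨m', ⟨hm, by rwa [e], by rw [e, e₁], by rw [e, e₂]⟩, e⟩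

theorem eventually_scale_proj (h : HolonomySystem (scale f U) (scale f.symm U) c D P)
    (hU : IsExpansivityNhd f U) (m : Leaf f U x₀ × Leaf f.symm U x₀) (N : ℤ) :
    ∀ᶠ m' in 𝓝 m, scale f U N (proj P m) (proj P (m'.1, m.2)) ∧
      scale f.symm U N (proj P m) (proj P (m.1, m'.2)) := by
  obtain ⟨S, hS⟩ := h.exists_scale_holonomy (m.1.exists_scale hU) (m.2.exists_scale hU.inv) N
  obtain ⟨S', hS'⟩ := h.swap.exists_scale_holonomy (m.2.exists_scale hU.inv)
    (m.1.exists_scale hU) N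
  filter_upwards [continuous_fst.continuousAt.eventually (Leaf.eventually_scale hU m.1 S),
    continuous_snd.continuousAt.eventually (Leaf.eventually_scale hU.inv m.2 S')] with m' h₁ h₂
  exact ⟨hS _ h₁, hS' _ h₂⟩

theorem continuous_proj (h : HolonomySystem (scale f U) (scale f.symm U) c D P)
    (hU : IsExpansivityNhd f U) : Continuous (proj (f := f) (U := U) (x₀ := x₀) P) := by
  refine continuous_iff_continuousAt.2 fun m => Metric.tendsto_nhds.2 fun ε hε => ?_
  obtain ⟨N₁, h₁⟩ := hU.dist_lt_of_scale (half_pos hε)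
  obtain ⟨N₂, h₂⟩ := hU.inv.dist_lt_of_scale (half_pos hε)
  have hc := h.scales.fst.nonneg
  have hD := h.fineE.1
  obtain ⟨N, hN, hN₁, hN₂⟩ : ∃ N : ℤ, 4 * c + D ≤ N ∧ N₁ ≤ N - c ∧ N₂ ≤ N :=
    ⟨max (4 * c + D) (max (N₁ + c) N₂), by omega, by omega, by omega⟩
  filter_upwards [h.eventually_scale_proj hU m N] with m' hm'
  have hcor := (h.scale_corner hN hm'.1 hm'.2).1
  rw [h.proj_base_change hU m m'] at hcor
  have d₁ := h₁ _ _ _ hcor 0 (by omega)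
  have d₂ := h₂ _ _ _ hm'.2 0 (by omega)
  change dist (proj P (m.1, m'.2)) (proj P m') < _ at d₁
  change dist (proj P m) (proj P (m.1, m'.2)) < _ at d₂
  rw [dist_comm]
  linarith [dist_triangle (proj P m) (proj P (m.1, m'.2)) (proj P m')]

/-- The sheets are open. -/
theorem eventually_sameSheet (h : HolonomySystem (scale f U) (scale f.symm U) c D P)
    (hU : IsExpansivityNhd f U) {R : Rectangle X} (hR : IsSmall f U (4 * c + D) R)
    {m : Leaf f U x₀ × Leaf f.symm U x₀} (hm : proj P m ∈ R.carrier) :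
    ∀ᶠ m' in 𝓝 m, SameSheet P R m m' := by
  have hc := h.scales.fst.nonneg
  have hD := h.fineE.1
  filter_upwards [h.eventually_scale_proj hU m (4 * c + D),
    (h.continuous_proj hU).continuousAt.eventually (R.isOpen_carrier.mem_nhds hm)] with m' h₁ h₂
  have hcor := h.scale_corner le_rfl h₁.1 h₁.2
  rw [h.proj_base_change hU m m'] at hcor
  refine ⟨hm, h₂, ?_, ?_⟩
  · exact h.scales.corner_unique (n := 4 * c + D) (m := 3 * c) h₁.1 (hR _ h₂ _ hm).1
      (h.scales.snd.symm (scale_mono hcor.2 (by omega)))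
      (scale_mono (hR _ h₂ _ hm).2 (by omega)) (by omega)
  · exact h.scales.corner_unique (n := 3 * c) (m := 4 * c + D)
      (h.scales.fst.symm (scale_mono hcor.1 (by omega)))
      (scale_mono (hR _ hm _ h₂).1 (by omega)) h₁.2 (hR _ hm _ h₂).2 (by omega)

/-- The inverse of the projection on a sheet is continuous. -/
theorem eventually_mem_of_sameSheet (h : HolonomySystem (scale f U) (scale f.symm U) c D P)
    (hU : IsExpansivityNhd f U) (hf : IsSmaleSpace f L) {R : Rectangle X}
    (hRL : L.IsSubrectangle R)
    {m : Leaf f U x₀ × Leaf f.symm U x₀} (hm : proj P m ∈ R.carrier)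
    {V : Set (Leaf f U x₀ × Leaf f.symm U x₀)} (hV : V ∈ 𝓝 m) :
    ∀ᶠ q in 𝓝 (proj P m), ∀ m', SameSheet P R m m' → proj P m' = q → m' ∈ V := by
  have ha := m.1.exists_scale hU
  have hb := m.2.exists_scale hU.inv
  obtain ⟨V₁, hV₁, V₂, hV₂, hVV⟩ := mem_nhds_prod_iff.1 hV
  obtain ⟨n₁, hn₁⟩ := (Leaf.mem_nhds_iff hU).1 hV₁
  obtain ⟨n₂, hn₂⟩ := (Leaf.mem_nhds_iff hU.inv).1 hV₂
  obtain ⟨S₁, hS₁⟩ := h.exists_scale_holonomy (h.memE ha hb) (h.equivF.symm hb) n₁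
  obtain ⟨S₂, hS₂⟩ := h.swap.exists_scale_holonomy (h.memF ha hb) (h.equivE.symm ha) n₂
  have t₁ : Tendsto (fun q : X => (q, proj P m)) (𝓝 (proj P m)) (𝓝 (proj P m, proj P m)) :=
    Continuous.tendsto' (by fun_prop) _ _ rfl
  have t₂ : Tendsto (fun q : X => (proj P m, q)) (𝓝 (proj P m)) (𝓝 (proj P m, proj P m)) :=
    Continuous.tendsto' (by fun_prop) _ _ rfl
  filter_upwards [t₁.eventually (hf.eventually_br hU hRL _ S₁),
    t₂.eventually (hf.eventually_br hU hRL _ S₂)] with q h₁ h₂ m' hm' hq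
  subst hq
  refine hVV ⟨hn₁ _ ?_, hn₂ _ ?_⟩
  · have e₁ : P m.2.val (proj P m) x₀ = m.1.val := h.proj_left_inv hU m
    have e₂ : P m.2.val (proj P (m'.1, m.2)) x₀ = m'.1.val := h.proj_left_inv hU (m'.1, m.2)
    have := hS₁ _ (h₁ hm'.2.1 hm).1
    change scale f U n₁ (P m.2.val (proj P m) x₀) _ at this
    rwa [← hm'.2.2.1, e₁, e₂] at this
  · have e₁ : P m.1.val x₀ (proj P m) = m.2.val := h.proj_right_inv hU m
    have e₂ : P m.1.val x₀ (proj P (m.1, m'.2)) = m'.2.val := h.proj_right_inv hU (m.1, m'.2)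
    have := hS₂ _ (h₂ hm hm'.2.1).2
    change scale f.symm U n₂ (P m.1.val x₀ (proj P m)) _ at this
    rwa [← hm'.2.2.2, e₁, e₂] at this

end HolonomySystem
end

noncomputable section

namespace HolonomySystem

variable {X : Type u} [MetricSpace X] [CompactSpace X] {f : X ≃ₜ X} {U : Set (X × X)}
  {L : LocalProductStructure X} {c D : ℤ} {P : X → X → X → X} {x₀ : X}

theorem isEvenlyCovered_proj (h : HolonomySystem (scale f U) (scale f.symm U) c D P)
    (hU : IsExpansivityNhd f U) (hf : IsSmaleSpace f L) {R : Rectangle X}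
    (hRL : L.IsSubrectangle R) (hR : IsSmall f U (4 * c + D) R) {x : X} (hx : x ∈ R.carrier) :
    IsEvenlyCovered (proj (f := f) (U := U) (x₀ := x₀) P) x
      (proj (f := f) (U := U) (x₀ := x₀) P ⁻¹' {x}) :=
  isEvenlyCovered_of_sheets (h.continuous_proj hU) R.isOpen_carrier (r := SameSheet P R)
    (fun _ _ hm => hm.symm) (fun _ _ _ => h.sameSheet_trans hU hR)
    (fun _ hm _ hq => h.exists_sameSheet hU hR hm hq) (fun _ _ => h.sameSheet_unique hU)
    (fun _ hm => h.eventually_sameSheet hU hR hm)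
    (fun _ hm _ hV => h.eventually_mem_of_sameSheet hU hf hRL hm hV) hx

/-- The sheet through `m` over a small rectangle is a rectangle of the product of the leaves. -/
def sheet (h : HolonomySystem (scale f U) (scale f.symm U) c D P) (hU : IsExpansivityNhd f U)
    {R : Rectangle X} (hR : IsSmall f U (4 * c + D) R) (m : Leaf f U x₀ × Leaf f.symm U x₀) :
    Rectangle (Leaf f U x₀ × Leaf f.symm U x₀) where
  carrier := {m' | SameSheet P R m m'}
  isOpen_carrier := isOpen_iff_mem_nhds.2 fun _ hm' =>
    (h.eventually_sameSheet hU hR hm'.2.1).mono fun _ hm'' => h.sameSheet_trans hU hR hm' hm''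
  br p q := (p.1, q.2)
  br_mem := fun p hp q hq => by
    have e : proj P (p.1, q.2) = R.br (proj P p) (proj P q) := by
      rw [← h.proj_base_change hU m (p.1, q.2), hp.2.2.1, hq.2.2.2,
        h.eq_br hR hp.1 hp.2.1 hq.2.1]
    refine ⟨hp.1, by rw [e]; exact R.br_mem _ hp.2.1 _ hq.2.1, ?_, ?_⟩
    · rw [e, R.br_br_left _ hp.2.1 _ hq.2.1 _ hp.1]; exact hp.2.2.1
    · rw [e, R.br_br_right _ hp.1 _ hp.2.1 _ hq.2.1]; exact hq.2.2.2
  continuousOn_br := by fun_prop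
  br_self := fun _ _ => rfl
  br_br_left := fun _ _ _ _ _ _ => rfl
  br_br_right := fun _ _ _ _ _ _ => rfl

theorem surjective_proj [ConnectedSpace X]
    (h : HolonomySystem (scale f U) (scale f.symm U) c D P) (hU : IsExpansivityNhd f U)
    (hR : ∀ x, ∃ R : Rectangle X, x ∈ R.carrier ∧ IsSmall f U (4 * c + D) R) :
    Function.Surjective (proj (f := f) (U := U) (x₀ := x₀) P) := by
  -- A small rectangle that meets the image of the projection is contained in it.
  have key : ∀ R : Rectangle X, IsSmall f U (4 * c + D) R →
      ∀ m : Leaf f U x₀ × Leaf f.symm U x₀, proj P m ∈ R.carrier →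
      R.carrier ⊆ range (proj (f := f) (U := U) (x₀ := x₀) P) := by
    intro R hR m hm q hq
    obtain ⟨m', -, hm'⟩ := h.exists_sameSheet hU hR hm hq
    exact ⟨m', hm'⟩
  have hclopen : IsClopen (range (proj (f := f) (U := U) (x₀ := x₀) P)) := by
    constructor
    · refine isOpen_compl_iff.1 (isOpen_iff_mem_nhds.2 fun x hx => ?_)
      obtain ⟨R, hxR, hR⟩ := hR x
      filter_upwards [R.isOpen_carrier.mem_nhds hxR] with y hy
      rintro ⟨m, rfl⟩
      exact hx (key R hR m hy hxR)
    · refine isOpen_iff_mem_nhds.2 ?_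
      rintro _ ⟨m, rfl⟩
      obtain ⟨R, hxR, hR⟩ := hR (proj P m)
      exact mem_of_superset (R.isOpen_carrier.mem_nhds hxR) (key R hR m hxR)
  have hbase : ∃ n, scale f U n x₀ x₀ := h.equivE.refl x₀
  have hbase' : ∃ n, scale f.symm U n x₀ x₀ := h.equivF.refl x₀
  exact range_eq_univ.1 (hclopen.eq_univ ⟨_, (Leaf.mk hU x₀ hbase, Leaf.mk hU.inv x₀ hbase'), rfl⟩)

/-- A horizontal plaque of a product is homeomorphic to the first factor. -/
def plaque₁Homeomorph {A : Type u} {B : Type v} [TopologicalSpace A] [TopologicalSpace B]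
    (m : A × B) : (Rectangle.prod A B).plaque₁ m ≃ₜ A where
  toFun y := y.1.1
  invFun a := ⟨(a, m.2), mem_univ _, rfl⟩
  left_inv := fun ⟨y, hy⟩ => Subtype.ext (Prod.ext rfl (congrArg Prod.snd hy.2).symm)
  right_inv _ := rfl
  continuous_toFun := continuous_fst.comp continuous_subtype_val
  continuous_invFun := Continuous.subtype_mk (by fun_prop) _

/-- A vertical plaque of a product is homeomorphic to the second factor. -/
def plaque₂Homeomorph {A : Type u} {B : Type v} [TopologicalSpace A] [TopologicalSpace B]
    (m : A × B) : (Rectangle.prod A B).plaque₂ m ≃ₜ B where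
  toFun y := y.1.2
  invFun b := ⟨(m.1, b), mem_univ _, rfl⟩
  left_inv := fun ⟨y, hy⟩ => Subtype.ext (Prod.ext (congrArg Prod.fst hy.2) rfl)
  right_inv _ := rfl
  continuous_toFun := continuous_snd.comp continuous_subtype_val
  continuous_invFun := Continuous.subtype_mk (by fun_prop) _

theorem isSplitting [ConnectedSpace X] [LocallyConnectedSpace X]
    (h : HolonomySystem (scale f U) (scale f.symm U) c D P) (hU : IsExpansivityNhd f U)
    (hf : IsSmaleSpace f L) (x₀ : X) :
    IsSplitting f U L (Rectangle.prod (Leaf f U x₀) (Leaf f.symm U x₀)) (proj P) where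
  carrier_eq := mem_univ
  isCoveringMap := fun x => by
    obtain ⟨R, hRL, -, hx, hR⟩ := hf.exists_small_rectangle hU x (4 * c + D)
    exact h.isEvenlyCovered_proj hU hf hRL hR hx
  surjective := h.surjective_proj hU fun x => by
    obtain ⟨R, -, -, hx, hR⟩ := hf.exists_small_rectangle hU x (4 * c + D)
    exact ⟨R, hx, hR⟩
  preserves := by
    refine ⟨h.continuous_proj hU, fun m => ?_⟩
    obtain ⟨R, hRL, -, hx, hR⟩ := hf.exists_small_rectangle hU (proj P m) (4 * c + D)
    refine ⟨h.sheet hU hR m, R, ?_, hRL, ?_, ?_, ?_⟩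
    · rintro _ rfl x
      exact ⟨univ, univ_mem, fun _ _ _ _ => rfl⟩
    · exact mem_of_mem_nhds (h.eventually_sameSheet hU hR hx)
    · refine Subset.antisymm (fun q hq => ?_) ?_
      · obtain ⟨m', hm', hq'⟩ := h.exists_sameSheet hU hR hx hq
        exact ⟨m', hm', hq'⟩
      · rintro _ ⟨m', hm', rfl⟩
        exact hm'.2.1
    · intro p hp q hq
      change proj P (p.1, q.2) = _
      rw [← h.proj_base_change hU m (p.1, q.2), hp.2.2.1, hq.2.2.2,
        h.eq_br hR hp.1 hp.2.1 hq.2.1]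
  stable := fun m => by
    refine ⟨(plaque₁Homeomorph m).trans
      (h.leafHomeomorph hU (m.1.exists_scale hU) (m.2.exists_scale hU.inv)), ?_⟩
    rintro ⟨m', hm'⟩
    have : m.2 = m'.2 := (congrArg Prod.snd hm'.2).symm
    change P x₀ m'.1.val m.2.val = P x₀ m'.1.val m'.2.val
    rw [this]
  unstable := fun m => by
    refine ⟨(plaque₂Homeomorph m).trans
      (h.swap.leafHomeomorph hU.inv (m.2.exists_scale hU.inv) (m.1.exists_scale hU)), ?_⟩
    rintro ⟨m', hm'⟩
    have := congrArg Prod.fst hm'.2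
    change m.1 = m'.1 at this
    change P x₀ m.1.val m'.2.val = P x₀ m'.1.val m'.2.val
    rw [this]

end HolonomySystem

/-! ### Continuation along stable leaves -/

theorem zpow_symm {X : Type*} [TopologicalSpace X] (f : X ≃ₜ X) (i : ℤ) :
    (f ^ i).symm = f ^ (-i) := by
  rw [zpow_neg]; rfl

section Continuation

variable {X : Type u} [MetricSpace X] [CompactSpace X] {f : X ≃ₜ X} {U : Set (X × X)}
  {L : LocalProductStructure X} {c D : ℤ} {P : X → X → X → X} {x₀ : X}

/-- A rectangle with the corners `p`, `q`, `r`, `s`, one pair of sides of which may be long if the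
other pair is short, is a step of the continuation: its image under `f ^ j` is contained in a small
connected rectangle. -/
theorem IsSmaleSpace.exists_holonomyStep [LocallyConnectedSpace X] (hf : IsSmaleSpace f L)
    (hU : IsExpansivityNhd f U) (hEF : ProductScales (scale f U) (scale f.symm U) c) :
    ∃ N : ℤ, ∀ (j : ℤ) (p q r s : X), scale f U (N - j) p q → scale f.symm U (N + j) p r →
      scale f U (N - j) r s → scale f.symm U (N + j) q s → L.HolonomyStep (p, r) (q, s) := by
  choose R hRL hRc hxR hR using fun x => hf.exists_small_rectangle hU x c
  obtain ⟨δ, hδ, hball⟩ := lebesgue_number_lemma_of_metric (isCompact_univ (X := X))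
    (fun x => (R x).isOpen_carrier) (fun x _ => mem_iUnion.2 ⟨x, hxR x⟩)
  obtain ⟨N₁, h₁⟩ := hU.dist_lt_of_scale hδ
  obtain ⟨N₂, h₂⟩ := hU.inv.dist_lt_of_scale hδ
  obtain ⟨N, hN₁, hN₂, hN₃⟩ : ∃ N : ℤ, N₁ ≤ N ∧ N₂ ≤ N ∧ c ≤ N :=
    ⟨max N₁ (max N₂ c), by omega, by omega, by omega⟩
  refine ⟨N, fun j p q r s hpq hpr hrs hqs => ?_⟩
  replace hpq := scale_zpow_iff.2 hpq
  replace hpr := scale_symm_zpow_iff.2 hpr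
  replace hrs := scale_zpow_iff.2 hrs
  replace hqs := scale_symm_zpow_iff.2 hqs
  obtain ⟨x, hx⟩ := hball ((f ^ j) p) (mem_univ _)
  have d₁ := h₁ _ _ _ hpq 0 (by omega)
  have d₂ := h₂ _ _ _ hpr 0 (by omega)
  change dist ((f ^ j) p) ((f ^ j) q) < δ at d₁
  change dist ((f ^ j) p) ((f ^ j) r) < δ at d₂
  have hp : (f ^ j) p ∈ (R x).carrier := hx (Metric.mem_ball_self hδ)
  have hq : (f ^ j) q ∈ (R x).carrier := hx (by rwa [Metric.mem_ball, dist_comm])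
  have hr : (f ^ j) r ∈ (R x).carrier := hx (by rwa [Metric.mem_ball, dist_comm])
  have hsymm : (f ^ (-j)).symm = f ^ j := by rw [zpow_symm, neg_neg]
  have hinv : ∀ y, (f ^ (-j)) ((f ^ j) y) = y := fun y => by
    rw [← zpow_add_apply, neg_add_cancel]; rfl
  have b₁ : (R x).br ((f ^ j) p) ((f ^ j) q) = (f ^ j) p :=
    hEF.corner_unique (hR x _ hp _ hq).1 (hEF.fst.symm (scale_mono hpq hN₃)) (hR x _ hp _ hq).2
      (hEF.snd.refl _ _) (by omega)
  have b₂ : (R x).br ((f ^ j) p) ((f ^ j) r) = (f ^ j) r :=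
    hEF.corner_unique (hR x _ hp _ hr).1 (hEF.fst.refl _ _) (hR x _ hp _ hr).2
      (scale_mono hpr hN₃) (by omega)
  have b₃ : (f ^ j) s = (R x).br ((f ^ j) q) ((f ^ j) r) :=
    hEF.corner_unique (scale_mono hrs hN₃) (hR x _ hq _ hr).1 (scale_mono hqs hN₃)
      (hR x _ hq _ hr).2 (by omega)
  refine ⟨(R x).map (f ^ (-j)), hf.isSubrectangle_map hU hEF (hRL x) _, ?_, ?_, ⟨?_, ?_⟩,
    ⟨?_, ?_⟩, ?_⟩
  · have := (hRc x).image _ ((f ^ (-j)).continuous.continuousOn)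
    rwa [Homeomorph.image_eq_preimage_symm] at this
  · change (f ^ (-j)).symm p ∈ (R x).carrier
    rwa [hsymm]
  · change (f ^ (-j)).symm q ∈ (R x).carrier
    rwa [hsymm]
  · change (f ^ (-j)) ((R x).br ((f ^ (-j)).symm p) ((f ^ (-j)).symm q)) = p
    rw [hsymm, b₁, hinv]
  · change (f ^ (-j)).symm r ∈ (R x).carrier
    rwa [hsymm]
  · change (f ^ (-j)) ((R x).br ((f ^ (-j)).symm p) ((f ^ (-j)).symm r)) = r
    rw [hsymm, b₂, hinv]
  · change s = (f ^ (-j)) ((R x).br ((f ^ (-j)).symm q) ((f ^ (-j)).symm r))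
    rw [hsymm, ← b₃, hinv]

/-- Existence of the continuation. -/
theorem HolonomySystem.continuesTo [LocallyConnectedSpace X]
    (h : HolonomySystem (scale f U) (scale f.symm U) c D P) (hU : IsExpansivityNhd f U)
    (hf : IsSmaleSpace f L) {x y : X} (hx : ∃ n, scale f U n x₀ x)
    (hy : ∃ n, scale f.symm U n x₀ y) : L.ContinuesTo x₀ y x (P x₀ x y) := by
  obtain ⟨N, hN⟩ := hf.exists_holonomyStep hU h.scales
  refine Relation.ReflTransGen.mono ?_ _ _ (h.exists_steps hx hy N)
  rintro p q ⟨j, h₁, h₂, h₃, h₄⟩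
  exact hN j _ _ _ _ h₁ h₂ h₃ h₄

end Continuation
end

noncomputable section

/-! ### Uniqueness of the continuation -/

namespace Rectangle

variable {X : Type u} [TopologicalSpace X] (R : Rectangle X) {p : X}

theorem br_of_mem_plaque₁ (hp : p ∈ R.carrier) {a a' : X} (ha : a ∈ R.plaque₁ p)
    (ha' : a' ∈ R.plaque₁ p) : R.br a' a = a' := by
  rw [← R.br_eq_of_mem_plaque₁ hp ha, R.br_br_right a' ha'.1 a ha.1 p hp,
    R.br_eq_of_mem_plaque₁ hp ha']

theorem br_of_mem_plaque₂ (hp : p ∈ R.carrier) {b b' : X} (hb : b ∈ R.plaque₂ p)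
    (hb' : b' ∈ R.plaque₂ p) : R.br b b' = b' := by
  have := R.br_br_left p hp b hb.1 b' hb'.1
  rwa [hb.2, hb'.2] at this

theorem isPreconnected_plaque₁ (hR : IsPreconnected R.carrier) (hp : p ∈ R.carrier) :
    IsPreconnected (R.plaque₁ p) := by
  have himg : (fun y => R.br y p) '' R.carrier = R.plaque₁ p := by
    refine Subset.antisymm ?_ fun a ha => ⟨a, ha.1, R.br_eq_of_mem_plaque₁ hp ha⟩
    rintro _ ⟨y, hy, rfl⟩
    exact R.br_mem_plaque₁ hy hp
  rw [← himg]
  exact hR.image _ (R.continuousOn_br.comp (f := fun y => (y, p)) (by fun_prop)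
    fun y hy => ⟨hy, hp⟩)

theorem continuousOn_br_left (hp : p ∈ R.carrier) : ContinuousOn (R.br p) R.carrier :=
  R.continuousOn_br.comp (f := fun y => (p, y)) (by fun_prop) fun _ hy => ⟨hp, hy⟩

theorem image_br_left (hp : p ∈ R.carrier) : R.br p '' R.carrier = R.plaque₂ p := by
  refine Subset.antisymm ?_ fun a ha => ⟨a, ha.1, ha.2⟩
  rintro _ ⟨y, hy, rfl⟩
  exact R.br_mem_plaque₂ hp hy

theorem isPreconnected_plaque₂ (hR : IsPreconnected R.carrier) (hp : p ∈ R.carrier) :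
    IsPreconnected (R.plaque₂ p) := by
  rw [← R.image_br_left hp]
  exact hR.image _ (R.continuousOn_br_left hp)

/-- Every point of a plaque has a compact connected neighbourhood in the plaque. -/
theorem exists_compact_connected_nhds [CompactSpace X] [RegularSpace X] [LocallyConnectedSpace X]
    (hp : p ∈ R.carrier) {b : X} (hb : b ∈ R.plaque₂ p) :
    ∃ K ⊆ R.plaque₂ p, IsCompact K ∧ IsPreconnected K ∧ b ∈ K ∧ K ∈ 𝓝[R.plaque₂ p] b := by
  obtain ⟨T, hT, hTc, hTR⟩ :=
    exists_mem_nhds_isClosed_subset (R.isOpen_carrier.mem_nhds hb.1)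
  obtain ⟨V, hVT, hVo, hbV, hVc⟩ := locallyConnectedSpace_iff_subsets_isOpen_isConnected.1
    inferInstance b T hT
  have hcl : closure V ⊆ R.carrier := (closure_minimal hVT hTc).trans hTR
  have hcont := (R.continuousOn_br_left hp).mono hcl
  have hmem : ∀ y ∈ V, y ∈ R.plaque₂ p → y ∈ R.br p '' closure V :=
    fun y hy hyp => ⟨y, subset_closure hy, hyp.2⟩
  refine ⟨R.br p '' closure V, ?_, isClosed_closure.isCompact.image_of_continuousOn hcont,
    hVc.closure.isPreconnected.image _ hcont, hmem b hbV hb, ?_⟩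
  · rw [← R.image_br_left hp]
    exact image_mono hcl
  · filter_upwards [mem_nhdsWithin_of_mem_nhds (hVo.mem_nhds hbV), self_mem_nhdsWithin]
      with y h₁ h₂ using hmem y h₁ h₂

end Rectangle

variable {X : Type u} [MetricSpace X] [CompactSpace X] {f : X ≃ₜ X} {U : Set (X × X)}
  {L : LocalProductStructure X} {c D : ℤ} {P : X → X → X → X} {R : Rectangle X} {p : X}

theorem IsSmaleSpace.eventually_plaque₁ (hf : IsSmaleSpace f L) (hU : IsExpansivityNhd f U)
    (hR : L.IsSubrectangle R) (hp : p ∈ R.carrier) {a : X} (ha : a ∈ R.plaque₁ p) (N : ℤ) :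
    ∀ᶠ a' in 𝓝 a, a' ∈ R.plaque₁ p → scale f U N a a' := by
  have t : Tendsto (fun a' : X => (a', a)) (𝓝 a) (𝓝 (a, a)) :=
    Continuous.tendsto' (by fun_prop) _ _ rfl
  filter_upwards [t.eventually (hf.eventually_br hU hR a N)] with a' h ha'
  have := (h ha'.1 ha.1).1
  rwa [R.br_of_mem_plaque₁ hp ha ha'] at this

theorem IsSmaleSpace.eventually_plaque₂ (hf : IsSmaleSpace f L) (hU : IsExpansivityNhd f U)
    (hR : L.IsSubrectangle R) (hp : p ∈ R.carrier) {b : X} (hb : b ∈ R.plaque₂ p) (N : ℤ) :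
    ∀ᶠ b' in 𝓝 b, b' ∈ R.plaque₂ p → scale f.symm U N b b' := by
  have t : Tendsto (fun b' : X => (b, b')) (𝓝 b) (𝓝 (b, b)) :=
    Continuous.tendsto' (by fun_prop) _ _ rfl
  filter_upwards [t.eventually (hf.eventually_br hU hR b N)] with b' h hb'
  have := (h hb.1 hb'.1).2
  rwa [R.br_of_mem_plaque₂ hp hb hb'] at this

theorem IsSmaleSpace.eventually_br_br₁ (hf : IsSmaleSpace f L) (hU : IsExpansivityNhd f U)
    (hR : L.IsSubrectangle R) {a b : X} (ha : a ∈ R.carrier) (hb : b ∈ R.carrier) (N : ℤ) :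
    ∀ᶠ z : X × X in 𝓝 (a, b), z.1 ∈ R.carrier → z.2 ∈ R.carrier →
      scale f U N (R.br a z.2) (R.br z.1 z.2) := by
  have hc : ContinuousAt (fun z : X × X => R.br z.1 z.2) (a, b) := R.continuousOn_br.continuousAt
    (prod_mem_nhds (R.isOpen_carrier.mem_nhds ha) (R.isOpen_carrier.mem_nhds hb))
  have t₁ : Tendsto (fun z : X × X => R.br a z.2) (𝓝 (a, b)) (𝓝 (R.br a b)) :=
    hc.tendsto.comp (Continuous.tendsto' (f := fun z : X × X => (a, z.2)) (by fun_prop) _ _ rfl)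
  filter_upwards [(hc.tendsto.prodMk_nhds t₁).eventually (hf.eventually_br hU hR _ N)]
    with z h h₁ h₂
  have := (h (R.br_mem _ h₁ _ h₂) (R.br_mem _ ha _ h₂)).1
  rwa [R.br_br_left _ h₁ _ h₂ _ (R.br_mem _ ha _ h₂), R.br_br_right _ h₁ _ ha _ h₂] at this

theorem IsSmaleSpace.eventually_br_br₂ (hf : IsSmaleSpace f L) (hU : IsExpansivityNhd f U)
    (hR : L.IsSubrectangle R) {a b : X} (ha : a ∈ R.carrier) (hb : b ∈ R.carrier) (N : ℤ) :
    ∀ᶠ b' in 𝓝 b, b' ∈ R.carrier → scale f.symm U N (R.br a b) (R.br a b') := by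
  have t : Tendsto (fun b' : X => (R.br a b, R.br a b')) (𝓝 b) (𝓝 (R.br a b, R.br a b)) :=
    tendsto_const_nhds.prodMk_nhds
      ((R.continuousOn_br_left ha).continuousAt (R.isOpen_carrier.mem_nhds hb)).tendsto
  filter_upwards [t.eventually (hf.eventually_br hU hR _ N)] with b' h hb'
  have := (h (R.br_mem _ ha _ hb) (R.br_mem _ ha _ hb')).2
  rwa [R.br_br_left _ ha _ hb _ (R.br_mem _ ha _ hb'), R.br_br_right _ ha _ ha _ hb'] at this

namespace HolonomySystem

/-- The plaques of a connected rectangle are contained in leaves. -/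
theorem exists_scale_plaque₁ (h : HolonomySystem (scale f U) (scale f.symm U) c D P)
    (hU : IsExpansivityNhd f U) (hf : IsSmaleSpace f L) (hR : L.IsSubrectangle R)
    (hRc : IsPreconnected R.carrier) (hp : p ∈ R.carrier) {a : X} (ha : a ∈ R.plaque₁ p) :
    ∃ n, scale f U n p a := by
  have hpp : p ∈ R.plaque₁ p := ⟨hp, R.br_self p hp⟩
  refine (R.isPreconnected_plaque₁ hRc hp).induction₂ (fun x y => ∃ n, scale f U n x y) ?_
    (fun _ _ _ _ _ _ => h.equivE.trans) (fun _ _ _ _ => h.equivE.symm) hpp ha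
  intro x hx
  filter_upwards [mem_nhdsWithin_of_mem_nhds (hf.eventually_plaque₁ hU hR hp hx 0),
    self_mem_nhdsWithin] with y h₁ h₂ using ⟨0, h₁ h₂⟩

theorem exists_scale_plaque₂ (h : HolonomySystem (scale f U) (scale f.symm U) c D P)
    (hU : IsExpansivityNhd f U) (hf : IsSmaleSpace f L) (hR : L.IsSubrectangle R)
    (hRc : IsPreconnected R.carrier) (hp : p ∈ R.carrier) {b : X} (hb : b ∈ R.plaque₂ p) :
    ∃ n, scale f.symm U n p b := by
  have hpp : p ∈ R.plaque₂ p := ⟨hp, R.br_self p hp⟩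
  refine (R.isPreconnected_plaque₂ hRc hp).induction₂ (fun x y => ∃ n, scale f.symm U n x y) ?_
    (fun _ _ _ _ _ _ => h.equivF.trans) (fun _ _ _ _ => h.equivF.symm) hpp hb
  intro x hx
  filter_upwards [mem_nhdsWithin_of_mem_nhds (hf.eventually_plaque₂ hU hR hp hx 0),
    self_mem_nhdsWithin] with y h₁ h₂ using ⟨0, h₁ h₂⟩

/-- If the bracket of `R` agrees with the holonomy on `{a} × K`, and `a'` is uniformly close to `a`
over `K`, then it is enough to check at one point of `K` that they agree on `{a'} × K`. -/
theorem br_eq_of_close (h : HolonomySystem (scale f U) (scale f.symm U) c D P)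
    (hU : IsExpansivityNhd f U) (hf : IsSmaleSpace f L) (hR : L.IsSubrectangle R)
    (hRc : IsPreconnected R.carrier) (hp : p ∈ R.carrier) {K : Set X} (hKR : K ⊆ R.plaque₂ p)
    (hK : IsPreconnected K) {a a' b₀ : X} (ha' : a' ∈ R.plaque₁ p)
    (hclose : ∀ b ∈ K, scale f U c (R.br a b) (R.br a' b) ∧ scale f U c (P p a b) (P p a' b))
    (hgood : ∀ b ∈ K, R.br a b = P p a b) (hb₀ : b₀ ∈ K) (he : R.br a' b₀ = P p a' b₀) :
    ∀ b ∈ K, R.br a' b = P p a' b := by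
  have hc := h.scales.fst.nonneg
  intro b hb
  refine hK.induction₂' (fun b b' => R.br a' b = P p a' b → R.br a' b' = P p a' b') ?_
    (fun _ _ _ _ _ _ h₁ h₂ h₃ => h₂ (h₁ h₃)) hb₀ hb he
  intro b hb
  obtain ⟨S, hS⟩ := h.swap.exists_scale_holonomy (h.exists_scale_plaque₂ hU hf hR hRc hp (hKR hb))
    (h.exists_scale_plaque₁ hU hf hR hRc hp ha') c
  filter_upwards [mem_nhdsWithin_of_mem_nhds (hf.eventually_br_br₂ hU hR ha'.1 (hKR hb).1 c),
    mem_nhdsWithin_of_mem_nhds (hf.eventually_plaque₂ hU hR hp (hKR hb) S),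
    self_mem_nhdsWithin] with b' h₁ h₂ hb'
  replace h₁ := h₁ (hKR hb').1
  replace h₂ : scale f.symm U c (P p a' b) (P p a' b') := hS _ (h₂ (hKR hb'))
  constructor
  · intro e
    rw [← e] at h₂
    have h₃ := (hclose b' hb').2
    rw [← hgood b' hb'] at h₃
    exact h.scales.corner_unique (hclose b' hb').1 h₃ h₁ h₂ (by omega)
  · intro e
    rw [← e] at h₂
    have h₃ := (hclose b hb).2
    rw [← hgood b hb] at h₃
    exact h.scales.corner_unique (hclose b hb).1 h₃ (h.scales.snd.symm h₁)
      (h.scales.snd.symm h₂) (by omega)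

/-- Points of the plaque of `a` that are close to `a` are uniformly close over a compact set. -/
theorem eventually_close (h : HolonomySystem (scale f U) (scale f.symm U) c D P)
    (hU : IsExpansivityNhd f U) (hf : IsSmaleSpace f L) (hR : L.IsSubrectangle R)
    (hRc : IsPreconnected R.carrier) (hp : p ∈ R.carrier) {K : Set X} (hKR : K ⊆ R.plaque₂ p)
    (hK : IsCompact K) {a : X} (ha : a ∈ R.plaque₁ p) :
    ∀ᶠ a' in 𝓝 a, ∀ b ∈ K, a' ∈ R.plaque₁ p → b ∈ R.plaque₂ p →
      scale f U c (R.br a b) (R.br a' b) ∧ scale f U c (P p a b) (P p a' b) := by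
  have hc := h.scales.fst.nonneg
  refine hK.eventually_forall_of_forall_eventually fun b hb => ?_
  obtain ⟨n, h₁, h₂⟩ := h.exists_bound (h.exists_scale_plaque₁ hU hf hR hRc hp ha)
    (h.exists_scale_plaque₂ hU hf hR hRc hp (hKR hb))
  obtain ⟨S, hS⟩ := (h.isHolonomy p (n - c)).cont_left c
  have t₁ : Tendsto (fun z : X × X => z.1) (𝓝 (a, b)) (𝓝 a) := continuous_fst.tendsto' _ _ rfl
  have t₂ : Tendsto (fun z : X × X => z.2) (𝓝 (a, b)) (𝓝 b) := continuous_snd.tendsto' _ _ rfl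
  filter_upwards [hf.eventually_br_br₁ hU hR ha.1 (hKR hb).1 c,
    t₁.eventually (hf.eventually_plaque₁ hU hR hp ha (max S n)),
    t₂.eventually (hf.eventually_plaque₂ hU hR hp (hKR hb) n)] with z e₁ e₂ e₃ hz₁ hz₂
  replace e₂ := e₂ hz₁
  refine ⟨e₁ hz₁.1 hz₂.1, hS _ _ _ (scale_mono h₁ (by omega)) ?_ ?_ (scale_mono e₂ (by omega))⟩
  · exact h.scales.fst.trans h₁ (scale_mono e₂ (by omega))
  · exact h.scales.snd.trans h₂ (e₃ hz₂)

/-- The bracket of a connected rectangle is the holonomy.  The points `b` for which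
`[a, b] = P p a b` for all `a` form an open and closed set: such a point has a compact connected
neighbourhood `K` in its plaque, and over `K` the equality spreads from `a = p` to all `a`, since
the sizes of the neighbourhoods of `a` in which it spreads are uniform over `K`. -/
theorem br_eq [LocallyConnectedSpace X]
    (h : HolonomySystem (scale f U) (scale f.symm U) c D P) (hU : IsExpansivityNhd f U)
    (hf : IsSmaleSpace f L) (hR : L.IsSubrectangle R) (hRc : IsPreconnected R.carrier)
    (hp : p ∈ R.carrier) {a b : X} (ha : a ∈ R.plaque₁ p) (hb : b ∈ R.plaque₂ p) :
    R.br a b = P p a b := by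
  have hpp₁ : p ∈ R.plaque₁ p := ⟨hp, R.br_self p hp⟩
  have hpp₂ : p ∈ R.plaque₂ p := ⟨hp, R.br_self p hp⟩
  have spread : ∀ K ⊆ R.plaque₂ p, IsCompact K → IsPreconnected K → ∀ b₀ ∈ K,
      (∀ a ∈ R.plaque₁ p, R.br a b₀ = P p a b₀) →
      ∀ b ∈ K, ∀ a ∈ R.plaque₁ p, R.br a b = P p a b := by
    intro K hKR hKc hK b₀ hb₀ hgood b hb a ha
    refine (R.isPreconnected_plaque₁ hRc hp).induction₂' (fun a a' =>
      (∀ b ∈ K, R.br a b = P p a b) → ∀ b ∈ K, R.br a' b = P p a' b) ?_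
      (fun _ _ _ _ _ _ h₁ h₂ h₃ => h₂ (h₁ h₃)) hpp₁ ha ?_ b hb
    · intro a ha
      filter_upwards [mem_nhdsWithin_of_mem_nhds
        (h.eventually_close hU hf hR hRc hp hKR hKc ha), self_mem_nhdsWithin] with a' h₁ ha'
      refine ⟨fun hg => ?_, fun hg => ?_⟩
      · exact h.br_eq_of_close hU hf hR hRc hp hKR hK ha'
          (fun b hb => h₁ b hb ha' (hKR hb)) hg hb₀ (hgood a' ha')
      · exact h.br_eq_of_close hU hf hR hRc hp hKR hK ha
          (fun b hb => (h₁ b hb ha' (hKR hb)).imp h.scales.fst.symm h.scales.fst.symm) hg hb₀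
          (hgood a ha)
    · intro b hb
      rw [(hKR hb).2, h.base_left (h.exists_scale_plaque₂ hU hf hR hRc hp (hKR hb))]
  refine (R.isPreconnected_plaque₂ hRc hp).induction₂' (fun b b' =>
    (∀ a ∈ R.plaque₁ p, R.br a b = P p a b) → ∀ a ∈ R.plaque₁ p, R.br a b' = P p a b') ?_
    (fun _ _ _ _ _ _ h₁ h₂ h₃ => h₂ (h₁ h₃)) hpp₂ hb ?_ a ha
  · intro b hb
    obtain ⟨K, hKR, hKc, hK, hbK, hKn⟩ := R.exists_compact_connected_nhds hp hb
    filter_upwards [hKn] with b' hb'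
    exact ⟨fun hg => spread K hKR hKc hK b hbK hg b' hb',
      fun hg => spread K hKR hKc hK b' hb' hg b hbK⟩
  · intro a ha
    rw [R.br_eq_of_mem_plaque₁ hp ha,
      h.base_right (h.exists_scale_plaque₁ hU hf hR hRc hp ha)]

/-- Uniqueness of the continuation. -/
theorem eq_of_continuesTo [LocallyConnectedSpace X]
    (h : HolonomySystem (scale f U) (scale f.symm U) c D P) (hU : IsExpansivityNhd f U)
    (hf : IsSmaleSpace f L) {x₀ x y z : X} (hy : ∃ n, scale f.symm U n x₀ y)
    (hz : L.ContinuesTo x₀ y x z) : P x₀ x y = z := by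
  suffices ∀ q : X × X, Relation.ReflTransGen L.HolonomyStep (x₀, y) q →
      (∃ n, scale f U n x₀ q.1) ∧ P x₀ q.1 y = q.2 from (this _ hz).2
  intro q hq
  induction hq with
  | refl => exact ⟨h.equivE.refl _, h.base_left hy⟩
  | @tail q q' _ hstep ih =>
    obtain ⟨R, hR, hRc, hqR, h₁, h₂, h₃⟩ := hstep
    have hleaf := h.exists_scale_plaque₁ hU hf hR hRc.isPreconnected hqR h₁
    refine ⟨h.equivE.trans ih.1 hleaf, ?_⟩
    rw [h₃, h.br_eq hU hf hR hRc.isPreconnected hqR h₁ h₂, ← ih.2,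
      h.base_changeE ih.1 (h.equivE.trans ih.1 hleaf) hy]

end HolonomySystem

/-- The holonomies of all leaves exist: this is where the pinching condition enters. -/
theorem exists_holonomySystem {X : Type u} [MetricSpace X] [CompactSpace X] [ConnectedSpace X]
    {f : X ≃ₜ X} {L : LocalProductStructure X} (hf : IsSmaleSpace f L) {U : Set (X × X)}
    (hU : IsExpansivityNhd f U) (hp : PinchedSpectrum f U) :
    ∃ c D P, HolonomySystem (scale f U) (scale f.symm U) c D P := by
  obtain ⟨c, hEF⟩ := hU.exists_productScales (hf.eventually_exists hU)
  obtain ⟨α₀, α₁, β₀, β₁, hα₀, hα₁, hβ₀, hβ₁, hlt⟩ :=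
    hp.exists_exponents hU (hf.eventually_exists hU 0)
  obtain ⟨A₀, hA₀, hE₀⟩ := hα₀.lowerExp hU
  obtain ⟨A₁, hA₁, hE₁⟩ := hα₁.upperExp hU
  obtain ⟨B₀, hB₀, hF₀⟩ := hβ₀.lowerExp hU.inv
  obtain ⟨B₁, hB₁, hF₁⟩ := hβ₁.upperExp hU.inv
  obtain ⟨D₁, hD₁⟩ := hEF.fst.exists_hasFineChains hE₁
  obtain ⟨D₂, hD₂⟩ := hEF.snd.exists_hasFineChains hF₁
  have hDE := hD₁.mono hEF.fst (le_max_left D₁ D₂)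
  have hDF := hD₂.mono hEF.snd (le_max_right D₁ D₂)
  choose P hP using fun x => exists_isHolonomy hEF hDE hDF
    (hEF.exists_isHolonomyOn hα₀.1 hα₁.1 hβ₀.1 hβ₁.1 hA₀ hA₁ hB₀ hB₁ hE₀ hE₁ hF₀ hF₁ hlt x)
  exact ⟨c, max D₁ D₂, P, hEF, hDE, hDF, hP⟩
end

theorem mainTheorem10 {X : Type u} [MetricSpace X] [CompactSpace X] [ConnectedSpace X]
    [LocallyConnectedSpace X] (f : X ≃ₜ X) (L : LocalProductStructure X)
    (hf : IsSmaleSpace f L) (U : Set (X × X)) (hU : IsExpansivityNhd f U)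
    (hp : PinchedSpectrum f U) :
    IsSplittable f U L ∧
    ∀ x₀ : X, ∃ π : Leaf f U x₀ × Leaf f.symm U x₀ → X,
      IsSplitting f U L (Rectangle.prod (Leaf f U x₀) (Leaf f.symm U x₀)) π ∧
      ∀ (x : Leaf f U x₀) (y : Leaf f.symm U x₀) (z : X),
        L.ContinuesTo x₀ y.val x.val z ↔ π (x, y) = z := by
  obtain ⟨c, D, P, h⟩ := exists_holonomySystem hf hU hp
  have hsplit := fun x₀ : X => h.isSplitting hU hf x₀
  refine ⟨?_, fun x₀ => ⟨_, hsplit x₀, fun x y z => ⟨?_, ?_⟩⟩⟩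
  · obtain ⟨x₀⟩ := (inferInstance : Nonempty X)
    exact ⟨_, _, _, _, hsplit x₀⟩
  · exact h.eq_of_continuesTo hU hf (y.exists_scale hU.inv)
  · rintro rfl
    exact h.continuesTo hU hf (x.exists_scale hU) (y.exists_scale hU.inv)
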